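/- **Setting.** Let $\Pr[\cdot]$ be a distribution over sequences in $\{0,1\}^T$, given together with a consistent choice of all conditionals: $\Pr[\,o\mid h]$ is a probability distribution on $o\in\{0,1\}$ for every history $h$ of length less than $T$ (also if $\Pr[h]=0$), with $\Pr[of\mid h]=\Pr[o\mid h]\Pr[f\mid ho]$ and $\Pr[\varphi\mid h]=1$ for the empty string $\varphi$; we write $\Pr[f]=\Pr[f\mid\varphi]$. It has *rank $r$* if for each $1\le t\le T$ the matrix $(\Pr[f\mid h])$ with rows $f\in\{0,1\}^{\le T-t}$ and columns $h\in\{0,1\}^t$ has rank at most $r$. The learner may query an exact oracle returning $\Pr[f\mid h]$ for any $h,f$ with $|h|+|f|\le T$, and may draw independent samples from $\Pr[\cdot]$ on $\{0,1\}^T$. Time is counted in steps of a real RAM: one step per arithmetic operation or comparison of exact real numbers, and for oracle calls and operations on strings and lists a number of steps proportional to the lengths involved. **Algorithm** (with parameter $n$). Set $B_t=\{0^t\}$ for $0\le t\le T$ and $\Lambda_T=\{\varphi\}$. For $t<T$ set $\Lambda_t=\{z_t\}$, where $z_t\in\{0,1\}$ is such that $\Pr[z_t\mid 0^t]\ne0$.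 For finite sets $F$ of futures and $H$ of histories write $\Pr[F\mid H]$ for the matrix with rows indexed by $F$ and columns by $H$. Repeat the following round: 1. By Gaussian elimination find matrices $\widehat A_{o,t}$ ($o\in\{0,1\}$, $0\le t<T$) with $\Pr[\Lambda_{t+1}\mid B_{t+1}]\,\widehat A_{o,t}=\Pr[o\Lambda_{t+1}\mid B_t]$. 2. Put $\overline{\Pr}[x_1\cdots x_t\lambda]=\Pr[\lambda\mid B_t]\,\widehat A_{x_t,t-1}\cdots\widehat A_{x_1,0}$ for $\lambda\in\Lambda_t$. For each $1\le t\le T$ draw $n$ fresh samples and keep their prefixes of length $t$. A prefix $x_1\cdots x_t$ is a counterexample if $\overline{\Pr}[x_1\cdots x_t\lambda]\neq\Pr[x_1\cdots x_t\lambda]$ for some $\lambda\in\Lambda_t$. 3. If there is a counterexample, find the least $s\in\{1,\dots,t\}$ such that $\overline{\Pr}[x_1\cdots x_s\lambda]\ne\Pr[x_1\cdots x_s\lambda]$ for some $\lambda\in\Lambda_s$. With $\tau=s-1$, add the history $x_1\cdots x_\tau$ to $B_\tau$ and the future $x_{s}\lambda$ to $\Lambda_\tau$. 4. If there is none, stop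 and return the matrices $\widehat A_{o,t}$ together with the bits $z_t$ and the rows $\Pr[z_t\mid B_t]$, $t<T$. The returned data represent the function $\widehat{\Pr}$ on $\{0,1\}^T$ defined by $\widehat{\Pr}[\varphi]=1$ and $\widehat{\Pr}[x_1\cdots x_{t+1}]=\widehat{\Pr}[x_1\cdots x_t]\cdot\widehat{\Pr}[x_{t+1}\mid x_1\cdots x_t]$, where $\widehat{\Pr}[z_t\mid x_1\cdots x_t]$ is the projection to $[0,1]$ of $\overline{\Pr}[x_1\cdots x_tz_t]/\widehat{\Pr}[x_1\cdots x_t]$ (read as $0$ if the denominator vanishes), and $\widehat{\Pr}[1-z_t\mid x_1\cdots x_t]=1-\widehat{\Pr}[z_t\mid x_1\cdots x_t]$. **Theorem.** There are a constant $C>0$ and a polynomial $p$ in four variables such that the following holds for all integers $T,r\ge1$, every rank-$r$ distribution $\Pr[\cdot]$ over $\{0,1\}^T$ (with its conditionals) and all $0<\varepsilon,\delta<1$. Run the algorithm with $n=\lceil C\,T^4\log(rT/\delta)/\varepsilon^2\rceil$. On every outcome of the samples that has positive probability, it stops within $p(r,T,1/\varepsilon,\log(1/\delta))$ steps and returns data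 for which $\widehat{\Pr}$ is a probability distribution on $\{0,1\}^T$; moreover, $\widehat{\Pr}[x]$ can be evaluated from these data, without any oracle, within $p(r,T,1/\varepsilon,\log(1/\delta))$ steps for each $x\in\{0,1\}^T$. With probability at least $1-\delta$, $$\mathrm{TV}(\Pr,\widehat{\Pr})=\frac12\sum_{x\in\{0,1\}^T}\bigl|\Pr[x]-\widehat{\Pr}[x]\bigr|\le\varepsilon .$$ -/

import Mathlib

/-! ### Distributions over binary sequences, given by their conditionals -/

/-- A distribution over binary sequences, presented through a consistent choice of all its
conditionals: `next h` is the law of the next observation after the history `h`, also when `h`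
itself has probability zero. For sequences of length `T` only histories shorter than `T` matter. -/
structure SeqDist where
  next : List Bool → PMF Bool

namespace SeqDist

/-- `P.cond h f` is `Pr[f | h]`; thus `Pr[o f | h] = Pr[o | h] * Pr[f | h o]`. -/
noncomputable def cond (P : SeqDist) : List Bool → List Bool → ℝ
  | _, [] => 1
  | h, o :: f => (P.next h o).toReal * P.cond (h ++ [o]) f

/-- `P.prob x = Pr[x]`, the probability that the sequence starts with `x`. -/
noncomputable def prob (P : SeqDist) (x : List Bool) : ℝ := P.cond [] x

/-- The law of the next `k` observations after the history `h`. -/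
noncomputable def future (P : SeqDist) : ℕ → List Bool → PMF (List Bool)
  | 0, _ => PMF.pure []
  | k + 1, h => (P.next h).bind fun o => (P.future k (h ++ [o])).map (List.cons o)

/-- The joint law of the observation sequence of length `T`. -/
noncomputable def joint (P : SeqDist) (T : ℕ) : PMF (List Bool) := P.future T []

/-- The matrix `Pr[O^{≤ T - t} | O^t]`: rows are futures, columns are histories of length `t`. -/
noncomputable def condMatrix (P : SeqDist) (T t : ℕ) :
    Matrix {f : List Bool // t + f.length ≤ T} (Fin t → Bool) ℝ :=
  Matrix.of fun f h => P.cond (List.ofFn h) f.1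

/-- `P` has rank (at most) `r` as a distribution over sequences of length `T`. -/
def HasRank (P : SeqDist) (T r : ℕ) : Prop :=
  ∀ t, 1 ≤ t → t ≤ T → (P.condMatrix T t).rank ≤ r

/-- Total variation distance, on sequences of length `T`, between `P` and `Q`. -/
noncomputable def tv (P : SeqDist) (T : ℕ) (Q : List Bool → ℝ) : ℝ :=
  (1 / 2) * ∑ x : Fin T → Bool, |P.prob (List.ofFn x) - Q (List.ofFn x)|

end SeqDist

/-! ### Step-counted programs

Programs of a real RAM with oracles. The programs below are polymorphic in the type `R` of scalars,
so a scalar can be touched only through the instructions listed here, each of which is charged. -/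

inductive ArithOp
  | add
  | sub
  | mul
  | div

/-- Programs returning an `α`. The proposition `access` says whether the oracles may be called. -/
inductive Prog (R : Type) (access : Prop) (α : Type) : Type
  | ret (a : α)
  | charge (m : ℕ) (k : Prog R access α)
  | lit (b : Bool) (k : R → Prog R access α)
  | arith (op : ArithOp) (x y : R) (k : R → Prog R access α)
  | testEq (x y : R) (k : Bool → Prog R access α)
  | testLe (x y : R) (k : Bool → Prog R access α)
  | query (ok : access) (h f : List Bool) (k : R → Prog R access α)
  | sample (ok : access) (k : List Bool → Prog R access α)

namespace Prog

variable {R : Type} {access : Prop} {α β γ : Type}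

/-- Sequential composition. -/
def bind : Prog R access α → (α → Prog R access β) → Prog R access β
  | ret a, g => g a
  | charge m k, g => charge m (k.bind g)
  | lit b k, g => lit b fun x => (k x).bind g
  | arith op x y k, g => arith op x y fun z => (k z).bind g
  | testEq x y k, g => testEq x y fun b => (k b).bind g
  | testLe x y k, g => testLe x y fun b => (k b).bind g
  | query ok h f k, g => query ok h f fun z => (k z).bind g
  | sample ok k, g => sample ok fun s => (k s).bind g

instance : Monad (Prog R access) where
  pure := ret
  bind := bind

/-- Spend `m` steps; this pays for work on lists, strings and loop counters. -/
def tick (m : ℕ) : Prog R access Unit := charge m (ret ())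
def zero : Prog R access R := lit false ret
def one : Prog R access R := lit true ret
def add (x y : R) : Prog R access R := arith .add x y ret
def sub (x y : R) : Prog R access R := arith .sub x y ret
def mul (x y : R) : Prog R access R := arith .mul x y ret
def div (x y : R) : Prog R access R := arith .div x y ret
def isEq (x y : R) : Prog R access Bool := testEq x y ret
def isLe (x y : R) : Prog R access Bool := testLe x y ret
/-- Ask for `Pr[f | h]`. -/
def askCond (h f : List Bool) : Prog R True R := query trivial h f ret
/-- Draw a fresh sequence from the joint distribution. -/
def draw : Prog R True (List Bool) := sample trivial ret

/-- Run `g` on every element of a list and collect the results. -/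
def forEach (g : β → Prog R access α) : List β → Prog R access (List α)
  | [] => ret []
  | b :: l => do
    tick 1
    let a ← g b
    let as ← forEach g l
    return a :: as

/-- Run `g` along a list until it first returns `some c`. -/
def findFirst (g : β → Prog R access (Option γ)) : List β → Prog R access (Option γ)
  | [] => ret none
  | b :: l => do
    tick 1
    match ← g b with
    | some c => return some c
    | none => findFirst g l

/-! #### Semantics over the real numbers -/

noncomputable def _root_.ArithOp.eval : ArithOp → ℝ → ℝ → ℝ
  | .add, x, y => x + y
  | .sub, x, y => x - y
  | .mul, x, y => x * y
  | .div, x, y => x / y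

/-- Result and number of steps of a program without oracles. -/
noncomputable def exec : Prog ℝ False α → α × ℕ
  | ret a => (a, 0)
  | charge m k => let out := k.exec; (out.1, out.2 + m)
  | lit b k => let out := (k (if b then 1 else 0)).exec; (out.1, out.2 + 1)
  | arith op x y k => let out := (k (op.eval x y)).exec; (out.1, out.2 + 1)
  | testEq x y k => let out := (k (decide (x = y))).exec; (out.1, out.2 + 1)
  | testLe x y k => let out := (k (decide (x ≤ y))).exec; (out.1, out.2 + 1)
  | query ok _ _ _ => ok.elim
  | sample ok _ => ok.elim

/-- Joint law of the result and of the number of steps of a program with access to the exact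
conditional probability oracle and to independent samples of length `T` from `P`. The oracle
answers `Pr[f | h]` if `h` and `f` have total length at most `T`, and reveals nothing otherwise.
Arithmetic operations and tests cost one step, oracle calls also the length of the strings. -/
noncomputable def run (P : SeqDist) (T : ℕ) : Prog ℝ True α → PMF (α × ℕ)
  | ret a => PMF.pure (a, 0)
  | charge m k => (k.run P T).map fun out => (out.1, out.2 + m)
  | lit b k => ((k (if b then 1 else 0)).run P T).map fun out => (out.1, out.2 + 1)
  | arith op x y k => ((k (op.eval x y)).run P T).map fun out => (out.1, out.2 + 1)
  | testEq x y k => ((k (decide (x = y))).run P T).map fun out => (out.1, out.2 + 1)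
  | testLe x y k => ((k (decide (x ≤ y))).run P T).map fun out => (out.1, out.2 + 1)
  | query _ h f k =>
      ((k (if h.length + f.length ≤ T then P.cond h f else 0)).run P T).map
        fun out => (out.1, out.2 + (1 + h.length + f.length))
  | sample _ k =>
      (P.joint T).bind fun s => ((k s).run P T).map fun out => (out.1, out.2 + (1 + T))

end Prog

/-! ### Linear algebra -/

namespace LinAlg

open Prog

variable {R : Type} {access : Prop}

def dot : List R → List R → Prog R access R
  | x :: u, y :: v => do
    let p ← mul x y
    let s ← dot u v
    add p s
  | _, _ => zero

def matVec (A : List (List R)) (v : List R) : Prog R access (List R) :=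
  forEach (fun row => dot row v) A

/-- The vector `u - c • v`. -/
def subScaled (c : R) : List R → List R → Prog R access (List R)
  | x :: u, y :: v => do
    let p ← mul c y
    let z ← sub x p
    let w ← subScaled c u v
    return z :: w
  | _, _ => return []

/-- The vector `w - ∑ j, c j • X j`. -/
def subComb (w : List R) : List R → List (List R) → Prog R access (List R)
  | c :: cs, v :: X => do
    let w' ← subScaled c w v
    subComb w' cs X
  | _, _ => return w

/-- Split off the first row whose leading coefficient is not zero. A row of a linear system is a
pair of its list of coefficients and its list of right hand sides. -/
def takePivot : List (List R × List R) →
    Prog R access (Option ((List R × List R) × List (List R × List R)))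
  | [] => return none
  | row :: rows => do
    tick 1
    let isZero ← (match row.1 with
      | [] => return true
      | a :: _ => do
        let z ← zero
        isEq a z)
    if isZero then
      match ← takePivot rows with
      | none => return none
      | some (p, rest) => return some (p, row :: rest)
    else
      return some (row, rows)

/-- Gaussian elimination: a solution `X`, as a list of `k` rows of width `m`, of the system `rows`
with `k` unknowns and `m` right hand sides. Unknowns without a pivot are set to zero. -/
def solve (m : ℕ) : ℕ → List (List R × List R) → Prog R access (List (List R))
  | 0, _ => return []
  | k + 1, rows => do
    match ← takePivot rows with
    | none =>
      let rest ← forEach (fun row => return (row.1.tail, row.2)) rows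
      let X ← solve m k rest
      let x ← forEach (fun _ => zero) (List.range m)
      return x :: X
    | some (([], _), _) => return []
    | some ((a :: as, b), rest) =>
      let p ← forEach (fun c => div c a) as
      let q ← forEach (fun c => div c a) b
      let rest' ← forEach (fun row => do
        match row.1 with
        | [] => return row
        | c :: cs =>
          let cs' ← subScaled c cs p
          let d ← subScaled c row.2 q
          return (cs', d)) rest
      let X ← solve m k rest'
      let x ← subComb q p X
      return x :: X

end LinAlg

/-! ### The learning algorithm -/

namespace ExactLearner

open Prog LinAlg

/-- Representative histories `B_t` and test futures `Λ_t` at one sequence length `t`. -/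
structure Cell where
  hist : List (List Bool)
  test : List (List Bool)

/-- The returned representation. For each `t < T`, `ops` holds the operators `A_{0,t}` and `A_{1,t}`
(matrices as lists of rows), and `tests` holds the initial test bit `z_t` with the
row `Pr[z_t | B_t]`. -/
structure Rep (R : Type) where
  ops : List (List (List R) × List (List R))
  tests : List (Bool × List R)

variable {R : Type} {access : Prop}

/-- The operator `A_o` of a pair `(A_0, A_1)`. -/
def pick (A : List (List R) × List (List R)) (o : Bool) : List (List R) :=
  if o then A.2 else A.1

def cellAt (cells : List Cell) (t : ℕ) : Prog R access Cell := do
  tick (t + 1)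
  return cells.getD t ⟨[], []⟩

/-- `B_t = {0^t}` for `t ≤ T`, `Λ_T = {φ}`, and for `t < T` the set `Λ_t` is `{0}` or `{1}` such that
`Pr[Λ_t | B_t] ≠ 0`. -/
def init (T : ℕ) : Prog R True (List Cell) :=
  forEach (fun t => do
    tick (t + 1)
    let b := List.replicate t false
    if t = T then
      return ⟨[b], [[]]⟩
    else
      let p ← askCond b [false]
      let z ← zero
      let isZero ← isEq p z
      return ⟨[b], [[isZero]]⟩) (List.range (T + 1))

/-- A row `Pr[f | B]`. -/
def condRow (f : List Bool) (B : List (List Bool)) : Prog R True (List R) :=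
  forEach (fun b => askCond b f) B

/-- A solution `A_{o,t}` of `Pr[Λ_{t+1} | B_{t+1}] A_{o,t} = Pr[o Λ_{t+1} | B_t]`. -/
def operator (cells : List Cell) (t : ℕ) (o : Bool) : Prog R True (List (List R)) := do
  let cur ← cellAt cells t
  let nxt ← cellAt cells (t + 1)
  let rows ← forEach (fun l => do
    let lhs ← condRow l nxt.hist
    let rhs ← condRow (o :: l) cur.hist
    return (lhs, rhs)) nxt.test
  tick (nxt.hist.length + cur.hist.length)
  solve cur.hist.length nxt.hist.length rows

def operators (cells : List Cell) (T : ℕ) :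
    Prog R True (List (List (List R) × List (List R))) :=
  forEach (fun t => do
    let A0 ← operator cells t false
    let A1 ← operator cells t true
    return (A0, A1)) (List.range T)

/-- The vector `A_{x_t,t-1} ⋯ A_{x_1,0} v`. -/
def push : List (List (List R) × List (List R)) → List Bool → List R → Prog R access (List R)
  | A :: ops, o :: x, v => do
    let w ← matVec (pick A o) v
    push ops x w
  | _, _, v => return v

/-- For a sequence `x` of length `t`, look for a test future `l ∈ Λ_t` for which the current
prediction `Pr[l | B_t] A_{x_t,t-1} ⋯ A_{x_1,0}` differs from `Pr[x l]`. -/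
def check (ops : List (List (List R) × List (List R))) (cells : List Cell) (x : List Bool) :
    Prog R True (Option (List Bool)) := do
  let cell ← cellAt cells x.length
  let u ← one
  let v ← push ops x [u]
  findFirst (fun l => do
    let row ← condRow l cell.hist
    let p ← dot row v
    let q ← askCond [] (x ++ l)
    let same ← isEq p q
    return if same then none else some l) cell.test

/-- The first `s ∈ {1, …, |x|}` at which the prediction for the prefix of length `s` is wrong,
together with a test future in `Λ_s` that shows it. -/
def locate (ops : List (List (List R) × List (List R))) (cells : List Cell) (x : List Bool) :
    Prog R True (Option (ℕ × List Bool)) :=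
  findFirst (fun s => do
    tick s
    match ← check ops cells (x.take s) with
    | none => return none
    | some l => return some (s, l)) (List.range' 1 x.length)

/-- Add the history `x_1 … x_τ` to `B_τ` and the future `x_{τ+1} l` to `Λ_τ`. -/
def extend (x : List Bool) (τ : ℕ) (l : List Bool) (cell : Cell) : Cell :=
  ⟨cell.hist ++ [x.take τ], cell.test ++ [x.getD τ false :: l]⟩

/-- `n` sampled sequences of each length `t ∈ {1, …, T}`. -/
def sampleAll (T n : ℕ) : Prog R True (List (List Bool)) := do
  let blocks ← forEach (fun t =>
    forEach (fun _ => do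
      let x ← draw
      return x.take t) (List.range n)) (List.range' 1 T)
  tick (T * n)
  return blocks.flatten

/-- The data `z_t` and `Pr[z_t | B_t]`, where `z_t` is the first element of `Λ_t`. -/
def testRows (cells : List Cell) (T : ℕ) : Prog R True (List (Bool × List R)) :=
  forEach (fun t => do
    let cell ← cellAt cells t
    let z := (cell.test.headD []).headD false
    let row ← condRow [z] cell.hist
    return (z, row)) (List.range T)

/-- One round: either a counterexample is found and used to enlarge one `B_τ` and `Λ_τ`, or the
current operators are returned. -/
def round (T n : ℕ) (cells : List Cell) : Prog R True (List Cell ⊕ Rep R) := do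
  let ops ← operators cells T
  let xs ← sampleAll T n
  let found ← findFirst (fun x => do
    match ← check ops cells x with
    | none => return none
    | some _ => return some x) xs
  match found with
  | none =>
    let tests ← testRows cells T
    return .inr ⟨ops, tests⟩
  | some x =>
    match ← locate ops cells x with
    | none => return .inl cells
    | some (s, l) =>
      tick (x.length + l.length + cells.length + (cells.map fun c => c.hist.length).sum)
      return .inl (cells.modify (s - 1) (extend x (s - 1) l))

/-- Rounds are repeated until one returns; `none` means that none of the first `N` rounds did. -/
def rounds (T n : ℕ) : ℕ → List Cell → Prog R True (Option (Rep R))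
  | 0, _ => return none
  | N + 1, cells => do
    tick 1
    match ← round T n cells with
    | .inl cells' => rounds T n N cells'
    | .inr rep => return some rep

/-- The learning algorithm for sequence length `T` with `n` samples for each length in each round,
observed for its first `N` rounds. -/
def learn (T n N : ℕ) : Prog R True (Option (Rep R)) := do
  let cells ← init T
  rounds T n N cells

/-- The projection of `q / p` to `[0, 1]`, read as `0` if `p = 0`. -/
def clipRatio (q p : R) : Prog R access R := do
  let z ← zero
  let u ← one
  if ← isEq p z then
    return z
  else
    let c ← div q p
    if ← isLe c z then
      return z
    else if ← isLe u c then
      return u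
    else
      return c

/-- The estimate of a sequence probability. With `v = A_{x_t,t-1} ⋯ A_{x_1,0}` and `p` the estimate
for the prefix `x_1 … x_t`, the conditional probability of `z_t` given this prefix is estimated by
the projection of `(Pr[z_t | B_t] v) / p` to `[0, 1]`. -/
def evalFrom : List (List (List R) × List (List R)) → List (Bool × List R) → List Bool →
    List R → R → Prog R access R
  | A :: ops, (z, row) :: tests, o :: x, v, p => do
    let q ← dot row v
    let c ← clipRatio q p
    let u ← one
    let d ← sub u c
    let p' ← mul p (if o = z then c else d)
    let v' ← matVec (pick A o) v
    evalFrom ops tests x v' p'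
  | _, _, _, _, p => return p

/-- The program that evaluates a representation, without any oracle. -/
def evaluate (rep : Rep R) (x : List Bool) : Prog R False R := do
  let u ← one
  evalFrom rep.ops rep.tests x [u] u

/-- The probability that the representation assigns to `x`. -/
noncomputable def Rep.prob (rep : Rep ℝ) (x : List Bool) : ℝ := (evaluate rep x).exec.1

/-- The number of steps needed to evaluate it. -/
noncomputable def Rep.evalSteps (rep : Rep ℝ) (x : List Bool) : ℕ := (evaluate rep x).exec.2

/-- The representation defines a probability distribution over sequences of length `T`. -/
def Rep.IsDistribution (rep : Rep ℝ) (T : ℕ) : Prop :=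
  (∀ x : Fin T → Bool, 0 ≤ rep.prob (List.ofFn x)) ∧
    ∑ x : Fin T → Bool, rep.prob (List.ofFn x) = 1

/-- The number `n` of samples for each length in each round, with a constant `C`. -/
noncomputable def sampleSize (C : ℝ) (r T : ℕ) (ε δ : ℝ) : ℕ :=
  ⌈C * (T : ℝ) ^ 4 * Real.log (r * T / δ) / ε ^ 2⌉₊

end ExactLearner

/-! Call a prefix good if the current operators predict it exactly together with every test of its
length. The loop maintains that each matrix Pr[Λ_t | B_t] is square and nonsingular (`Inv`). Hence
the linear systems for the operators are solvable, and for t ≥ 1 the histories in B_t give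
independent columns of the conditional matrix, so that |B_t| ≤ r.

Let s be the first bad length of a sampled sequence and y its prefix of length s - 1. Since y is
good, its state vector represents Pr[y] · Pr[f | y] for all f in Λ_{s-1}. By the equation defining
the operators, the failing test λ at length s says that this fails for the future x_s λ. As Pr[y] >
0, bordering the matrix by the history y and the future x_s λ gives a nonzero Schur complement, so
nonsingularity survives (`CellOK.extend`). Time 0 is never extended, because predictions of length
one are automatically exact (`good_singleton`). Each round that does not return therefore adds one
history; their number starts at T + 1 and never exceeds 1 + rT (`Inv.histCount_le`), which bounds
the number of rounds.

For accuracy: on a sequence whose prefixes shorter than T are good, clipping does nothing and the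
estimate is exact (`RepOK.evalVal_eq`). The total variation distance is thus at most the mass of
sequences with a bad prefix, hence at most ε if the bad mass at each length is at most ε/T
(`RepOK.tv_le`). If some length has bad mass above ε/T, its n samples, drawn after the operators are
fixed, are all good with probability at most (1 - ε/T)^n (`law_sampleAll_le`). A union bound over at
most rT rounds finishes the argument.

Two readings of programs serve these halves: `Sat` bounds steps and describes results on every
possible outcome, while `law` forgets the steps and keeps the probabilities. -/

/-! ### Program logic -/

namespace Prog

variable {access : Prop} {α β γ : Type}

/-- Every possible outcome of the program, with its number of steps, satisfies `Q`. -/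
def wp (P : SeqDist) (T : ℕ) : Prog ℝ access α → (α → ℕ → Prop) → Prop
  | ret a, Q => Q a 0
  | charge m k, Q => wp P T k fun a c => Q a (c + m)
  | lit b k, Q => wp P T (k (if b then 1 else 0)) fun a c => Q a (c + 1)
  | arith op x y k, Q => wp P T (k (op.eval x y)) fun a c => Q a (c + 1)
  | testEq x y k, Q => wp P T (k (decide (x = y))) fun a c => Q a (c + 1)
  | testLe x y k, Q => wp P T (k (decide (x ≤ y))) fun a c => Q a (c + 1)
  | query _ h f k, Q => wp P T (k (if h.length + f.length ≤ T then P.cond h f else 0))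
      fun a c => Q a (c + (1 + h.length + f.length))
  | sample _ k, Q => ∀ s ∈ (P.joint T).support, wp P T (k s) fun a c => Q a (c + (1 + T))

theorem wp_mono {P : SeqDist} {T : ℕ} (p : Prog ℝ access α) {Q Q' : α → ℕ → Prop}
    (h : wp P T p Q) (hQ : ∀ a c, Q a c → Q' a c) : wp P T p Q' := by
  induction p generalizing Q Q' with
  | ret a => exact hQ _ _ h
  | charge m k ih => exact ih h fun a c => hQ _ _
  | lit b k ih => exact ih _ h fun a c => hQ _ _
  | arith op x y k ih => exact ih _ h fun a c => hQ _ _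
  | testEq x y k ih => exact ih _ h fun a c => hQ _ _
  | testLe x y k ih => exact ih _ h fun a c => hQ _ _
  | query ok h' f k ih => exact ih _ h fun a c => hQ _ _
  | sample ok k ih => exact fun s hs => ih _ (h s hs) fun a c => hQ _ _

theorem wp_bind {P : SeqDist} {T : ℕ} (p : Prog ℝ access α) (g : α → Prog ℝ access β)
    {Q : β → ℕ → Prop} (h : wp P T p fun a c => wp P T (g a) fun b c' => Q b (c' + c)) :
    wp P T (p.bind g) Q := by
  induction p generalizing Q with
  | ret a => exact h
  | charge m k ih =>
    exact ih (wp_mono _ h fun a c h' => wp_mono _ h' fun b c' h'' => by rwa [add_assoc])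
  | lit b k ih =>
    exact ih _ (wp_mono _ h fun a c h' => wp_mono _ h' fun b c' h'' => by rwa [add_assoc])
  | arith op x y k ih =>
    exact ih _ (wp_mono _ h fun a c h' => wp_mono _ h' fun b c' h'' => by rwa [add_assoc])
  | testEq x y k ih =>
    exact ih _ (wp_mono _ h fun a c h' => wp_mono _ h' fun b c' h'' => by rwa [add_assoc])
  | testLe x y k ih =>
    exact ih _ (wp_mono _ h fun a c h' => wp_mono _ h' fun b c' h'' => by rwa [add_assoc])
  | query ok h' f k ih =>
    exact ih _ (wp_mono _ h fun a c h' => wp_mono _ h' fun b c' h'' => by rwa [add_assoc])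
  | sample ok k ih =>
    exact fun s hs => ih _ (wp_mono _ (h s hs) fun a c h' => wp_mono _ h' fun b c' h'' => by
      rwa [add_assoc])

theorem wp_exec {P : SeqDist} {T : ℕ} (p : Prog ℝ False α) {Q : α → ℕ → Prop}
    (h : wp P T p Q) : Q p.exec.1 p.exec.2 := by
  induction p generalizing Q with
  | ret a => exact h
  | charge m k ih => exact ih h
  | lit b k ih => exact ih _ h
  | arith op x y k ih => exact ih _ h
  | testEq x y k ih => exact ih _ h
  | testLe x y k ih => exact ih _ h
  | query ok h' f k ih => exact ok.elim
  | sample ok k ih => exact ok.elim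

/-- Sampling in `wp` quantifies only over the support of the joint law, so a `wp` statement is
exactly strong enough for outcomes of positive probability. -/
theorem wp_run {P : SeqDist} {T : ℕ} (p : Prog ℝ True α) {Q : α → ℕ → Prop}
    (h : wp P T p Q) : ∀ out ∈ (p.run P T).support, Q out.1 out.2 := by
  induction p generalizing Q with
  | ret a =>
    intro out ho
    rw [run, PMF.mem_support_pure_iff] at ho
    subst ho
    exact h
  | charge m k ih =>
    intro out ho
    rw [run, PMF.mem_support_map_iff] at ho
    obtain ⟨o, ho, rfl⟩ := ho
    exact ih h o ho
  | lit b k ih =>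
    intro out ho
    rw [run, PMF.mem_support_map_iff] at ho
    obtain ⟨o, ho, rfl⟩ := ho
    exact ih _ h o ho
  | arith op x y k ih =>
    intro out ho
    rw [run, PMF.mem_support_map_iff] at ho
    obtain ⟨o, ho, rfl⟩ := ho
    exact ih _ h o ho
  | testEq x y k ih =>
    intro out ho
    rw [run, PMF.mem_support_map_iff] at ho
    obtain ⟨o, ho, rfl⟩ := ho
    exact ih _ h o ho
  | testLe x y k ih =>
    intro out ho
    rw [run, PMF.mem_support_map_iff] at ho
    obtain ⟨o, ho, rfl⟩ := ho
    exact ih _ h o ho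
  | query ok h' f k ih =>
    intro out ho
    rw [run, PMF.mem_support_map_iff] at ho
    obtain ⟨o, ho, rfl⟩ := ho
    exact ih _ h o ho
  | sample ok k ih =>
    intro out ho
    rw [run, PMF.mem_support_bind_iff] at ho
    obtain ⟨s, hs, ho⟩ := ho
    rw [PMF.mem_support_map_iff] at ho
    obtain ⟨o, ho, rfl⟩ := ho
    exact ih _ (h s hs) o ho

/-- Every possible outcome satisfies `Q` and is reached within `B` steps. -/
def Sat (P : SeqDist) (T : ℕ) (p : Prog ℝ access α) (B : ℕ) (Q : α → Prop) : Prop :=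
  wp P T p fun a c => c ≤ B ∧ Q a

variable {P : SeqDist} {T : ℕ} {B B₁ B₂ : ℕ}

theorem Sat.mono {p : Prog ℝ access α} {Q Q' : α → Prop} (h : Sat P T p B₁ Q) (hB : B₁ ≤ B₂)
    (hQ : ∀ a, Q a → Q' a) : Sat P T p B₂ Q' :=
  wp_mono p h fun a _ h => ⟨h.1.trans hB, hQ a h.2⟩

theorem Sat.le {p : Prog ℝ access α} {Q : α → Prop} (h : Sat P T p B₁ Q) (hB : B₁ ≤ B₂) :
    Sat P T p B₂ Q := h.mono hB fun _ => id

theorem Sat.imp {p : Prog ℝ access α} {Q Q' : α → Prop} (h : Sat P T p B Q)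
    (hQ : ∀ a, Q a → Q' a) : Sat P T p B Q' := h.mono le_rfl hQ

/-- The budget `B₂` has to be uniform in the intermediate result; costs that depend on data are
therefore first replaced by uniform bounds. -/
theorem Sat.bind {p : Prog ℝ access α} {g : α → Prog ℝ access β} {Q₁ : α → Prop} {Q₂ : β → Prop}
    (h₁ : Sat P T p B₁ Q₁) (h₂ : ∀ a, Q₁ a → Sat P T (g a) B₂ Q₂) :
    Sat P T (p >>= g) (B₁ + B₂) Q₂ :=
  wp_bind p g <| wp_mono p h₁ fun a _ h => wp_mono _ (h₂ a h.2) fun _ _ h' =>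
    ⟨by omega, h'.2⟩

theorem Sat.pure {Q : α → Prop} {a : α} (h : Q a) :
    Sat P T (Pure.pure a : Prog ℝ access α) 0 Q := ⟨le_rfl, h⟩

theorem sat_tick (m : ℕ) : Sat P T (tick m : Prog ℝ access Unit) m fun _ => True :=
  ⟨by omega, trivial⟩

theorem sat_zero : Sat P T (zero : Prog ℝ access ℝ) 1 (· = 0) := ⟨le_rfl, by simp⟩

theorem sat_one : Sat P T (one : Prog ℝ access ℝ) 1 (· = 1) := ⟨le_rfl, by simp⟩

theorem sat_add (x y : ℝ) : Sat P T (add x y : Prog ℝ access ℝ) 1 (· = x + y) := ⟨le_rfl, rfl⟩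

theorem sat_sub (x y : ℝ) : Sat P T (sub x y : Prog ℝ access ℝ) 1 (· = x - y) := ⟨le_rfl, rfl⟩

theorem sat_mul (x y : ℝ) : Sat P T (mul x y : Prog ℝ access ℝ) 1 (· = x * y) := ⟨le_rfl, rfl⟩

theorem sat_div (x y : ℝ) : Sat P T (div x y : Prog ℝ access ℝ) 1 (· = x / y) := ⟨le_rfl, rfl⟩

theorem sat_isEq (x y : ℝ) : Sat P T (isEq x y : Prog ℝ access Bool) 1 (· = decide (x = y)) :=
  ⟨le_rfl, rfl⟩

theorem sat_isLe (x y : ℝ) : Sat P T (isLe x y : Prog ℝ access Bool) 1 (· = decide (x ≤ y)) :=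
  ⟨le_rfl, rfl⟩

theorem sat_askCond {h f : List Bool} (hT : h.length + f.length ≤ T) :
    Sat P T (askCond h f) (1 + T) (· = P.cond h f) :=
  ⟨by omega, by simp [hT]⟩

theorem sat_draw : Sat P T draw (1 + T) (· ∈ (P.joint T).support) :=
  fun _ hs => ⟨by omega, hs⟩

theorem sat_forEach {g : β → Prog ℝ access α} {R : β → α → Prop} :
    ∀ {l : List β}, (∀ b ∈ l, Sat P T (g b) B (R b)) →
      Sat P T (forEach g l) (l.length * (B + 1)) fun as => List.Forall₂ R l as
  | [], _ => ⟨by simp, .nil⟩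
  | b :: l, h => by
    rw [Prog.forEach]
    refine ((sat_tick 1).bind fun _ _ => (h b (by simp)).bind fun a ha =>
      (sat_forEach (l := l) fun b hb => h b (by simp [hb])).bind fun as has =>
        Sat.pure (.cons ha has)).le ?_
    simp only [List.length_cons, Nat.succ_mul]
    omega

theorem sat_forEach_map {g : β → Prog ℝ access α} {f : β → α} {l : List β}
    (h : ∀ b ∈ l, Sat P T (g b) B (· = f b)) :
    Sat P T (forEach g l) (l.length * (B + 1)) (· = l.map f) :=
  (sat_forEach h).imp fun as has => by
    clear h
    induction has with
    | nil => rfl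
    | cons h _ ih => rw [h, ih, List.map_cons]

/-- The clean initial segment `l₁` is recorded because minimality of the hit is needed later: all
shorter prefixes of a located counterexample must be good. -/
theorem sat_findFirst {g : β → Prog ℝ access (Option γ)} {N : β → Prop} {S : β → γ → Prop} :
    ∀ {l : List β}, (∀ b ∈ l, Sat P T (g b) B fun o =>
        (o = none → N b) ∧ ∀ c, o = some c → S b c) →
      Sat P T (findFirst g l) (l.length * (B + 1)) fun o =>
        (o = none → ∀ b ∈ l, N b) ∧
        ∀ c, o = some c → ∃ l₁ b l₂, l = l₁ ++ b :: l₂ ∧ (∀ b' ∈ l₁, N b') ∧ S b c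
  | [], _ => ⟨by simp, by simp⟩
  | b :: l, h => by
    rw [Prog.findFirst]
    refine ((sat_tick 1).bind fun _ _ => (h b (by simp)).bind (B₂ := l.length * (B + 1))
      fun a ha => ?_).le ?_
    · match a, ha with
      | some c, ha =>
        refine Sat.le (Sat.pure ⟨by simp, fun c' hc' => ⟨[], b, l, rfl, by simp, ?_⟩⟩) (by simp)
        exact ha.2 c' hc'
      | none, ha =>
        refine (sat_findFirst (l := l) fun b hb => h b (by simp [hb])).imp fun o ho => ⟨?_, ?_⟩
        · intro h0
          simpa using ⟨ha.1 rfl, ho.1 h0⟩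
        · intro c hc
          obtain ⟨l₁, b', l₂, rfl, h1, h2⟩ := ho.2 c hc
          exact ⟨b :: l₁, b', l₂, rfl, by simpa using ⟨ha.1 rfl, h1⟩, h2⟩
    · simp only [List.length_cons, Nat.succ_mul]
      omega

/-! ### Laws of results -/

/-- The law of the result of a program. -/
noncomputable def law (P : SeqDist) (T : ℕ) (p : Prog ℝ True α) : PMF α :=
  (p.run P T).map Prod.fst

theorem law_pure (a : α) : law P T (Pure.pure a) = PMF.pure a := by
  show (PMF.pure (a, 0)).map Prod.fst = _
  rw [PMF.pure_map]

theorem law_bind (p : Prog ℝ True α) (g : α → Prog ℝ True β) :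
    law P T (p >>= g) = (law P T p).bind fun a => law P T (g a) := by
  show law P T (p.bind g) = _
  have key : ∀ (q : PMF (β × ℕ)) (f : ℕ → ℕ),
      (q.map fun out => (out.1, f out.2)).map Prod.fst = q.map Prod.fst := fun q f => by
    rw [PMF.map_comp]; rfl
  have key' : ∀ (q : PMF (α × ℕ)) (f : ℕ → ℕ),
      (q.map fun out => (out.1, f out.2)).map Prod.fst = q.map Prod.fst := fun q f => by
    rw [PMF.map_comp]; rfl
  unfold law at *
  induction p with
  | ret a => simp only [Prog.bind, run, PMF.pure_map, PMF.pure_bind]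
  | charge m k ih => simpa only [Prog.bind, run, key _ (· + m), key' _ (· + m)] using ih
  | lit b k ih => simpa only [Prog.bind, run, key _ (· + 1), key' _ (· + 1)] using ih _
  | arith op x y k ih => simpa only [Prog.bind, run, key _ (· + 1), key' _ (· + 1)] using ih _
  | testEq x y k ih => simpa only [Prog.bind, run, key _ (· + 1), key' _ (· + 1)] using ih _
  | testLe x y k ih => simpa only [Prog.bind, run, key _ (· + 1), key' _ (· + 1)] using ih _
  | query ok h f k ih =>
    simpa only [Prog.bind, run, key _ (· + (1 + h.length + f.length)),
      key' _ (· + (1 + h.length + f.length))] using ih _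
  | sample ok k ih =>
    simp only [Prog.bind, run, PMF.map_bind, key _ (· + (1 + T)), key' _ (· + (1 + T)), ih,
      PMF.bind_bind]

theorem law_tick (m : ℕ) : law P T (tick m) = PMF.pure () := by
  simp [law, tick, run, PMF.pure_map]

theorem law_draw : law P T draw = P.joint T := by
  simp only [law, draw, run, PMF.pure_map, PMF.map_bind]
  exact PMF.bind_pure _

theorem Sat.law {p : Prog ℝ True α} {Q : α → Prop} (h : Sat P T p B Q) :
    ∀ a ∈ (law P T p).support, Q a := by
  intro a ha
  rw [Prog.law, PMF.mem_support_map_iff] at ha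
  obtain ⟨out, ho, rfl⟩ := ha
  exact (wp_run p h out ho).2

/-! ### Failure probabilities under sequential composition -/

theorem _root_.PMF.toOuterMeasure_le_one {α : Type} (p : PMF α) (s : Set α) :
    p.toOuterMeasure s ≤ 1 :=
  (MeasureTheory.measure_mono (Set.subset_univ s)).trans
    (by rw [(PMF.toOuterMeasure_apply_eq_one_iff p _).2 (Set.subset_univ _)])

/-- Union bound for two stages: either the first stage lands in the exceptional set `u`, or the
second stage fails with conditional probability at most `b`. -/
theorem _root_.PMF.toOuterMeasure_bind_le {α β : Type} (p : PMF α) (g : α → PMF β) (s : Set β)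
    (u : Set α) (a b : ENNReal) (hu : p.toOuterMeasure u ≤ a)
    (h : ∀ x ∈ p.support, x ∉ u → (g x).toOuterMeasure s ≤ b) :
    (p.bind g).toOuterMeasure s ≤ a + b := by
  classical
  rw [PMF.toOuterMeasure_bind_apply]
  calc ∑' x, p x * (g x).toOuterMeasure s
      ≤ ∑' x, (u.indicator p x + p x * b) := by
        refine ENNReal.tsum_le_tsum fun x => ?_
        by_cases hx : x ∈ u
        · rw [Set.indicator_of_mem hx]
          refine le_add_right ?_
          calc p x * (g x).toOuterMeasure s ≤ p x * 1 := by
                gcongr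
                exact PMF.toOuterMeasure_le_one _ _
            _ = p x := mul_one _
        · rw [Set.indicator_of_notMem hx, zero_add]
          by_cases h0 : p x = 0
          · simp [h0]
          · gcongr
            exact h x ((PMF.mem_support_iff _ _).2 h0) hx
    _ = p.toOuterMeasure u + b := by
        rw [ENNReal.tsum_add, ENNReal.tsum_mul_right, PMF.tsum_coe, one_mul,
          PMF.toOuterMeasure_apply]
    _ ≤ a + b := by gcongr

theorem _root_.PMF.toOuterMeasure_bind_le' {α β : Type} (p : PMF α) (g : α → PMF β) (s : Set β)
    (b : ENNReal) (h : ∀ x ∈ p.support, (g x).toOuterMeasure s ≤ b) :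
    (p.bind g).toOuterMeasure s ≤ b := by
  simpa using PMF.toOuterMeasure_bind_le p g s ∅ 0 b (by simp) fun x hx _ => h x hx

/-- Successive runs of the loop body share no state, so they are independent and the probabilities
multiply. -/
theorem law_forEach_all (g : β → Prog ℝ True α) (G : Set α) :
    ∀ l : List β, (law P T (forEach g l)).toOuterMeasure {as | ∀ a ∈ as, a ∈ G} =
      (l.map fun b => (law P T (g b)).toOuterMeasure G).prod
  | [] => by
    rw [forEach]
    show (law P T (Pure.pure [])).toOuterMeasure _ = _
    rw [law_pure, PMF.toOuterMeasure_pure_apply]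
    simp
  | b :: l => by
    classical
    rw [forEach, law_bind, law_tick, PMF.pure_bind, law_bind, PMF.toOuterMeasure_bind_apply,
      List.map_cons, List.prod_cons, ← law_forEach_all g G l, PMF.toOuterMeasure_apply _ G,
      ← ENNReal.tsum_mul_right]
    refine tsum_congr fun a => ?_
    simp only [law_bind, law_pure]
    by_cases ha : a ∈ G
    · rw [Set.indicator_of_mem ha]
      congr 1
      rw [PMF.toOuterMeasure_bind_apply, PMF.toOuterMeasure_apply]
      refine tsum_congr fun as => ?_
      rw [PMF.toOuterMeasure_pure_apply]
      by_cases has : ∀ a ∈ as, a ∈ G <;> simp [Set.indicator, ha, has]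
    · rw [Set.indicator_of_notMem ha, zero_mul]
      refine mul_eq_zero_of_right _ ?_
      rw [PMF.toOuterMeasure_bind_apply]
      simp [PMF.toOuterMeasure_pure_apply, ha]

end Prog

/-! ### Correctness and cost of the linear algebra -/

namespace LinAlg

open Prog Finset

variable {access : Prop} {P : SeqDist} {T : ℕ}

/-- The value of `dot`. -/
def ldot : List ℝ → List ℝ → ℝ
  | x :: u, y :: v => x * y + ldot u v
  | _, _ => 0

/-- Reading lists with default 0 pads them by zeros, so any range covering `v` gives the same sum
and `u` may have any length. -/
theorem ldot_eq_sum : ∀ (u v : List ℝ) (k : ℕ), v.length ≤ k →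
    ldot u v = ∑ i ∈ range k, u.getD i 0 * v.getD i 0
  | [], v, k, _ => by simp [ldot]
  | x :: u, [], k, _ => by simp [ldot]
  | x :: u, y :: v, 0, h => by simp at h
  | x :: u, y :: v, k + 1, h => by
    rw [ldot, sum_range_succ', ldot_eq_sum u v k (by simpa using h), add_comm]
    simp

theorem sat_dot : ∀ u v : List ℝ,
    Sat P T (dot u v : Prog ℝ access ℝ) (2 * v.length + 1) (· = ldot u v)
  | x :: u, y :: v => by
    rw [dot, ldot]
    refine ((sat_mul x y).bind fun p hp => (sat_dot u v).bind fun s hs =>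
      (sat_add p s).imp fun z hz => ?_).le ?_
    · rw [hz, hp, hs]
    · simp only [List.length_cons]; omega
  | [], v => by
    rw [dot, ldot]
    · exact (sat_zero).le (by omega)
    · simp
    · simp
  | x :: u, [] => by
    rw [dot, ldot]
    · exact (sat_zero).le (by omega)
    · simp
    · simp

theorem sat_matVec (A : List (List ℝ)) (v : List ℝ) :
    Sat P T (matVec A v : Prog ℝ access (List ℝ)) (A.length * (2 * v.length + 2))
      (· = A.map fun row => ldot row v) :=
  sat_forEach_map fun row _ => sat_dot row v

theorem sat_subScaled (c : ℝ) : ∀ u v : List ℝ,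
    Sat P T (subScaled c u v : Prog ℝ access (List ℝ)) (2 * v.length)
      (· = List.zipWith (fun x y => x - c * y) u v)
  | x :: u, y :: v => by
    rw [subScaled]
    refine ((sat_mul c y).bind fun p hp => (sat_sub x p).bind fun z hz =>
      (sat_subScaled c u v).bind fun w hw => Sat.pure ?_).le ?_
    · rw [hz, hp, hw]; rfl
    · simp only [List.length_cons]; omega
  | [], v => by
    rw [subScaled]
    · exact (Sat.pure (by simp)).le (by omega)
    · simp
  | x :: u, [] => by
    rw [subScaled]
    · exact (Sat.pure (by simp)).le (by omega)
    · simp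

theorem getD_zipWith_sub (c : ℝ) : ∀ (u v : List ℝ) (_ : u.length = v.length) (i : ℕ),
    (List.zipWith (fun x y => x - c * y) u v).getD i 0 = u.getD i 0 - c * v.getD i 0
  | [], [], _, i => by simp
  | x :: u, y :: v, h, 0 => by simp
  | x :: u, y :: v, h, i + 1 => by
    simpa using getD_zipWith_sub c u v (by simpa using h) i

theorem sat_subComb (m : ℕ) : ∀ (cs : List ℝ) (X : List (List ℝ)) (w : List ℝ),
    w.length = m → (∀ x ∈ X, x.length = m) → cs.length = X.length →
    Sat P T (subComb w cs X : Prog ℝ access (List ℝ)) (cs.length * (2 * m)) fun W =>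
      W.length = m ∧ ∀ j, W.getD j 0 = w.getD j 0 -
        ∑ i ∈ range cs.length, cs.getD i 0 * (X.getD i []).getD j 0
  | [], [], w, hw, _, _ => by
    rw [subComb]
    · exact (Sat.pure ⟨hw, by simp⟩).le (by omega)
    · simp
  | c :: cs, v :: X, w, hw, hX, h => by
    rw [subComb]
    have hv : v.length = m := hX v (by simp)
    refine ((sat_subScaled c w v).bind fun w' hw' => (sat_subComb m cs X w' ?_
      (fun x hx => hX x (by simp [hx])) (by simpa using h)).imp fun W hW =>
        ⟨hW.1, fun j => ?_⟩).le ?_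
    · rw [hw', List.length_zipWith, hw, hv, min_self]
    · rw [List.length_cons, hv, Nat.succ_mul cs.length]; omega
    · rw [hW.2 j, hw', getD_zipWith_sub c w v (hw.trans hv.symm), List.length_cons,
        sum_range_succ']
      simp only [List.getD_cons_zero, List.getD_cons_succ]
      ring

theorem sat_takePivot : ∀ rows : List (List ℝ × List ℝ),
    Sat P T (takePivot rows : Prog ℝ access _) (3 * rows.length) fun o =>
      (o = none → ∀ row ∈ rows, row.1.getD 0 0 = 0) ∧
      ∀ pr, o = some pr → (∃ a as, pr.1.1 = a :: as ∧ a ≠ 0) ∧ (pr.1 :: pr.2).Perm rows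
  | [] => by
    rw [takePivot]
    exact Sat.pure ⟨by simp, by simp⟩
  | row :: rows => by
    rw [takePivot]
    refine ((sat_tick 1).bind fun _ _ => Sat.bind (B₁ := 2) (B₂ := 3 * rows.length)
      (Q₁ := fun b : Bool => (b = true → row.1.getD 0 0 = 0) ∧
        (b = false → ∃ a as, row.1 = a :: as ∧ a ≠ 0)) ?_ fun b hb => ?_).le ?_
    · obtain ⟨l, r⟩ := row
      cases l with
      | nil => exact (Sat.pure ⟨by simp, by simp⟩).le (by omega)
      | cons a as =>
        refine (sat_zero).bind fun z hz => (sat_isEq a z).imp fun b hb => ?_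
        subst hz hb
        simp
    · cases b with
      | false =>
        refine (Sat.pure ⟨by simp, fun pr hpr => ?_⟩).le (by omega)
        obtain rfl := Option.some.inj hpr
        exact ⟨hb.2 rfl, List.Perm.refl _⟩
      | true =>
        refine ((sat_takePivot rows).bind (B₂ := 0) fun o ho => ?_).le (by omega)
        match o, ho with
        | none, ho => exact Sat.pure ⟨fun _ => List.forall_mem_cons.2 ⟨hb.1 rfl, ho.1 rfl⟩, by simp⟩
        | some (p, rest), ho =>
          refine Sat.pure ⟨by simp, fun pr hpr => ?_⟩
          obtain rfl := Option.some.inj hpr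
          obtain ⟨h1, h2⟩ := ho.2 _ rfl
          exact ⟨h1, (List.Perm.swap _ _ _).trans (h2.cons row)⟩
    · simp only [List.length_cons]; omega

/-- A bound on the work that Gaussian elimination does for one unknown. -/
def pivotCost {S : Type*} [CommSemiring S] (K : S) : S := 6 * K * K + 9 * K

/-- Gaussian elimination solves every consistent system. -/
theorem sat_solve {m K : ℕ} (hm : m ≤ K) : ∀ (k : ℕ) (rows : List (List ℝ × List ℝ)), k ≤ K →
    rows.length ≤ K → (∀ row ∈ rows, row.1.length = k ∧ row.2.length = m) →
    (∃ Y : ℕ → ℕ → ℝ, ∀ row ∈ rows, ∀ j < m,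
      ∑ i ∈ range k, row.1.getD i 0 * Y i j = row.2.getD j 0) →
    Sat P T (solve m k rows : Prog ℝ access _) (k * pivotCost K) fun X =>
      X.length = k ∧ (∀ x ∈ X, x.length = m) ∧ ∀ row ∈ rows, ∀ j < m,
        ∑ i ∈ range k, row.1.getD i 0 * (X.getD i []).getD j 0 = row.2.getD j 0
  | 0, rows, _, _, _, ⟨Y, hY⟩ => by
    rw [solve]
    exact Sat.le (Sat.pure ⟨rfl, by simp, fun row hrow j hj => by simpa using hY row hrow j hj⟩)
      (by omega)
  | k + 1, rows, hk, hR, hw, ⟨Y, hY⟩ => by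
    have hfin : (k + 1) * pivotCost K = k * pivotCost K + (6 * K * K + 9 * K) := by
      rw [Nat.succ_mul, pivotCost]
    rw [solve]
    refine ((sat_takePivot rows).bind (B₂ := k * pivotCost K + (6 * K * K + 6 * K))
      fun o ho => ?_).le (by rw [hfin]; omega)
    match o, ho with
    | none, ho =>
      refine ((sat_forEach_map (B := 0) (f := fun row : List ℝ × List ℝ => (row.1.tail, row.2))
        fun row _ => Sat.pure rfl).bind (B₂ := k * pivotCost K + 2 * m) fun rest hrest => ?_).le
          (by nlinarith)
      subst hrest
      -- Without a pivot the first column vanishes: the first unknown is free, and deleting it keeps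
      -- the system consistent.
      have h0 := ho.1 rfl
      refine ((sat_solve hm k _ (by omega) (by simpa using hR) ?_ ⟨fun i => Y (i + 1), ?_⟩).bind
        (B₂ := 2 * m) fun X hX => ((sat_forEach_map (B := 1) (f := fun _ => (0 : ℝ))
          fun _ _ => sat_zero).bind (B₂ := 0) fun x hx => Sat.pure ?_).le ?_)
      · intro row' hrow'
        obtain ⟨row, hrow, rfl⟩ := List.mem_map.1 hrow'
        have := hw row hrow
        simp [this.1, this.2]
      · intro row' hrow' j hj
        obtain ⟨row, hrow, rfl⟩ := List.mem_map.1 hrow'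
        rw [← hY row hrow j hj, sum_range_succ', h0 row hrow]
        obtain ⟨l, r⟩ := row
        cases l <;> simp
      · subst hx
        refine ⟨by simp [hX.1], ?_, ?_⟩
        · intro y hy
          rcases List.mem_cons.1 hy with rfl | hy
          · simp
          · exact hX.2.1 y hy
        · intro row hrow j hj
          have := hX.2.2 _ (List.mem_map_of_mem hrow) j hj
          rw [sum_range_succ', h0 row hrow, ← this]
          obtain ⟨l, r⟩ := row
          cases l <;> simp
      · simp; omega
    | some (([], _), _), ho =>
      obtain ⟨⟨a, as, h, _⟩, _⟩ := ho.2 _ rfl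
      cases h
    | some ((a :: as, b), rest), ho =>
      obtain ⟨⟨a', as', h, ha⟩, hperm⟩ := ho.2 _ rfl
      obtain ⟨rfl, rfl⟩ := List.cons.inj h
      have hmem : ∀ row, row ∈ rows ↔ row = (a :: as, b) ∨ row ∈ rest := fun row => by
        rw [← hperm.mem_iff, List.mem_cons]
      have hpiv := hw _ ((hmem _).2 (.inl rfl))
      have has : as.length = k := by simpa using hpiv.1
      have hb : b.length = m := hpiv.2
      have hrl : rest.length ≤ K := by
        have := hperm.length_eq
        simp at this
        omega
      refine ((sat_forEach_map (B := 1) (f := fun c => c / a) fun c _ => sat_div c a).bind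
        (B₂ := k * pivotCost K + (6 * K * K + 3 * K)) fun p hp =>
        ((sat_forEach_map (B := 1) (f := fun c => c / a) fun c _ => sat_div c a).bind
        (B₂ := k * pivotCost K + (6 * K * K + K)) fun q hq => ?_).le ?_).le ?_
      rotate_left
      · rw [hb]; nlinarith
      · rw [has]; nlinarith
      have hpl : p.length = k := by rw [hp, List.length_map, has]
      have hql : q.length = m := by rw [hq, List.length_map, hb]
      have hpi : ∀ i, as.getD i 0 = a * p.getD i 0 := fun i => by
        rw [hp, ← zero_div a, List.getD_map, mul_div_cancel₀ _ ha]; simp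
      have hqi : ∀ i, b.getD i 0 = a * q.getD i 0 := fun i => by
        rw [hq, ← zero_div a, List.getD_map, mul_div_cancel₀ _ ha]; simp
      -- The normalized pivot row expresses the first unknown of any solution by the others.
      -- Substituting this in the remaining rows shows that the reduced system is still solved by
      -- the tail of `Y`.
      have hpivY : ∀ j < m, Y 0 j = q.getD j 0 - ∑ i ∈ range k, p.getD i 0 * Y (i + 1) j := by
        intro j hj
        have := hY _ ((hmem _).2 (.inl rfl)) j hj
        rw [sum_range_succ'] at this
        simp only [List.getD_cons_succ, List.getD_cons_zero, hpi, hqi, mul_assoc,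
          ← mul_sum] at this
        rw [← mul_add] at this
        linear_combination mul_left_cancel₀ ha this
      refine ((sat_forEach_map (B := 4 * K) (f := fun row : List ℝ × List ℝ =>
        (List.zipWith (fun x y => x - row.1.headD 0 * y) row.1.tail p,
          List.zipWith (fun x y => x - row.1.headD 0 * y) row.2 q)) fun row hrow => ?_).bind
        (B₂ := k * pivotCost K + 2 * K * K) fun rest' hrest' => ?_).le ?_
      · obtain ⟨l, r⟩ := row
        have hl := (hw _ ((hmem _).2 (.inr hrow))).1
        cases l with
        | nil => simp at hl
        | cons c cs =>
          refine ((sat_subScaled c cs p).bind fun cs' hcs' => (sat_subScaled c r q).bind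
            (B₂ := 0) fun d hd => Sat.pure ?_).le ?_
          · rw [hcs', hd]; rfl
          · rw [hpl, hql]; omega
      rotate_left
      · nlinarith
      subst hrest'
      refine (sat_solve hm k _ (by omega) (by simpa using hrl) ?_ ⟨fun i => Y (i + 1), ?_⟩).bind
        (B₂ := 2 * K * K) fun X hX => ?_
      · intro row' hrow'
        obtain ⟨row, hrow, rfl⟩ := List.mem_map.1 hrow'
        have := hw _ ((hmem _).2 (.inr hrow))
        simp [this.1, this.2, hpl, hql]
      · intro row' hrow' j hj
        obtain ⟨⟨l, r⟩, hrow, rfl⟩ := List.mem_map.1 hrow'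
        have hl := hw _ ((hmem _).2 (.inr hrow))
        have hy := hY _ ((hmem _).2 (.inr hrow)) j hj
        cases l with
        | nil => simp at hl
        | cons c cs =>
          simp only [List.headD_cons, List.tail_cons]
          simp only [List.length_cons, Nat.add_right_cancel_iff] at hl
          simp only [getD_zipWith_sub c cs p (by rw [hl.1, hpl]),
            getD_zipWith_sub c r q (by rw [hl.2, hql]), sub_mul, sum_sub_distrib]
          rw [sum_range_succ', hpivY j hj] at hy
          simp only [List.getD_cons_succ, List.getD_cons_zero] at hy
          simp only [mul_assoc, ← mul_sum]
          linear_combination hy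
      · refine ((sat_subComb m p X q hql hX.2.1 (hpl.trans hX.1.symm)).bind (B₂ := 0)
          fun x hx => Sat.pure ⟨by simp [hX.1], ?_, ?_⟩).le ?_
        · rw [hpl]; nlinarith [Nat.mul_le_mul (show k ≤ K by omega) hm]
        · intro y hy
          rcases List.mem_cons.1 hy with rfl | hy
          · exact hx.1
          · exact hX.2.1 y hy
        · intro row hrow j hj
          rw [sum_range_succ']
          simp only [List.getD_cons_succ, List.getD_cons_zero]
          rw [hx.2 j, hpl]
          -- The pivot row holds by the choice of `x` in back substitution; every other row is its
          -- reduced row plus a multiple of the pivot row.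
          rcases (hmem _).1 hrow with rfl | hrow
          · simp only [List.getD_cons_succ, List.getD_cons_zero, hpi, hqi, mul_assoc, ← mul_sum]
            ring
          · obtain ⟨l, r⟩ := row
            have hl := hw _ ((hmem _).2 (.inr hrow))
            have hy := hX.2.2 _ (List.mem_map_of_mem hrow) j hj
            cases l with
            | nil => simp at hl
            | cons c cs =>
              simp only [List.headD_cons, List.tail_cons] at hy
              simp only [List.length_cons, Nat.add_right_cancel_iff] at hl
              simp only [getD_zipWith_sub c cs p (by rw [hl.1, hpl]),
                getD_zipWith_sub c r q (by rw [hl.2, hql]), sub_mul, sum_sub_distrib] at hy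
              simp only [mul_assoc, ← mul_sum] at hy
              simp only [List.getD_cons_succ, List.getD_cons_zero]
              linear_combination hy

end LinAlg

/-! ### Sequence distributions -/

namespace SeqDist

variable (P : SeqDist)

theorem cond_nonneg : ∀ h f : List Bool, 0 ≤ P.cond h f
  | _, [] => zero_le_one
  | h, o :: f => mul_nonneg ENNReal.toReal_nonneg (cond_nonneg (h ++ [o]) f)

theorem cond_append : ∀ h a b : List Bool, P.cond h (a ++ b) = P.cond h a * P.cond (h ++ a) b
  | h, [], b => by simp [cond]
  | h, o :: a, b => by
    rw [List.cons_append, cond, cond, cond_append (h ++ [o]) a b]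
    simp [mul_assoc]

theorem prob_append (a b : List Bool) : P.prob (a ++ b) = P.prob a * P.cond a b := by
  simpa [prob] using P.cond_append [] a b

theorem prob_nonneg (a : List Bool) : 0 ≤ P.prob a := P.cond_nonneg _ _

theorem cond_singleton (h : List Bool) (o : Bool) : P.cond h [o] = (P.next h o).toReal := by
  simp [cond]

theorem cond_not_add (h : List Bool) (o : Bool) : P.cond h [!o] + P.cond h [o] = 1 := by
  rw [cond_singleton, cond_singleton, ← ENNReal.toReal_add ((P.next h).apply_ne_top _)
    ((P.next h).apply_ne_top _), ← ENNReal.toReal_one, ← (P.next h).tsum_coe, tsum_bool]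
  cases o <;> simp [add_comm]

theorem sum_ofFn_succ {M : Type*} [AddCommMonoid M] (n : ℕ) (f : List Bool → M) :
    ∑ x : Fin (n + 1) → Bool, f (List.ofFn x) =
      (∑ x : Fin n → Bool, f (true :: List.ofFn x)) +
        ∑ x : Fin n → Bool, f (false :: List.ofFn x) := by
  rw [← (Fin.consEquiv fun _ => Bool).sum_comp, Fintype.sum_prod_type]
  simp [List.ofFn_succ]

theorem sum_cond : ∀ (n : ℕ) (h : List Bool), ∑ x : Fin n → Bool, P.cond h (List.ofFn x) = 1
  | 0, h => by simp [cond]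
  | n + 1, h => by
    rw [sum_ofFn_succ n fun x => P.cond h x]
    simp only [cond, ← Finset.mul_sum, sum_cond n, mul_one]
    have := P.cond_not_add h false
    rwa [cond_singleton, cond_singleton] at this

theorem sum_prob (n : ℕ) : ∑ x : Fin n → Bool, P.prob (List.ofFn x) = 1 := P.sum_cond n []

theorem future_apply : ∀ (k : ℕ) (h f : List Bool),
    P.future k h f = if f.length = k then ENNReal.ofReal (P.cond h f) else 0
  | 0, h, f => by
    rw [future, PMF.pure_apply]
    cases f <;> simp [cond]
  | k + 1, h, f => by
    classical
    rw [future, PMF.bind_apply, tsum_bool]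
    have hmap : ∀ o, ((P.future k (h ++ [o])).map (List.cons o)) f =
        if f.head? = some o then P.future k (h ++ [o]) f.tail else 0 := by
      intro o
      rw [PMF.map_apply]
      cases f with
      | nil => simp
      | cons a f =>
        by_cases ha : a = o
        · subst ha
          rw [tsum_eq_single f]
          · simp
          · intro b hb
            simp [Ne.symm hb]
        · simp [ha]
    rw [hmap, hmap]
    cases f with
    | nil => simp
    | cons a f =>
      have e : ∀ o, P.next h o * (if f.length = k then ENNReal.ofReal (P.cond (h ++ [o]) f) else 0)
          = if f.length = k then ENNReal.ofReal (P.cond h (o :: f)) else 0 := fun o => by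
        split_ifs
        · rw [cond, ENNReal.ofReal_mul ENNReal.toReal_nonneg,
            ENNReal.ofReal_toReal ((P.next h).apply_ne_top _)]
        · simp
      cases a <;> simp [future_apply k, e]

theorem joint_apply (T : ℕ) (x : List Bool) :
    P.joint T x = if x.length = T then ENNReal.ofReal (P.prob x) else 0 :=
  P.future_apply T [] x

theorem length_of_mem_support {T : ℕ} {x : List Bool} (hx : x ∈ (P.joint T).support) :
    x.length = T := by
  rw [PMF.mem_support_iff, joint_apply] at hx
  by_contra h
  simp [h] at hx

/-- Only prefixes of samples become new histories, and their positive probability is what permits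
dividing by Pr[y] in `CellOK.extend`. -/
theorem prob_take_pos {T : ℕ} {x : List Bool} (hx : x ∈ (P.joint T).support) (t : ℕ) :
    0 < P.prob (x.take t) := by
  have hl := P.length_of_mem_support hx
  rw [PMF.mem_support_iff, joint_apply, if_pos hl] at hx
  refine (P.prob_nonneg _).lt_of_ne fun h => hx ?_
  rw [← List.take_append_drop t x, prob_append, ← h, zero_mul, ENNReal.ofReal_zero]

theorem toOuterMeasure_joint (T : ℕ) (E : Set (List Bool)) [DecidablePred (· ∈ E)] :
    (P.joint T).toOuterMeasure E =
      ENNReal.ofReal (∑ x : Fin T → Bool, if List.ofFn x ∈ E then P.prob (List.ofFn x) else 0) := by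
  classical
  rw [PMF.toOuterMeasure_apply, tsum_eq_sum (s := Finset.univ.image (List.ofFn (n := T))),
    Finset.sum_image, ENNReal.ofReal_sum_of_nonneg]
  · refine Finset.sum_congr rfl fun x _ => ?_
    by_cases hx : List.ofFn x ∈ E <;> simp [Set.indicator, hx, joint_apply]
  · intro x _
    split_ifs
    · exact P.prob_nonneg _
    · exact le_rfl
  · exact fun x _ y _ h => List.ofFn_injective h
  · intro x hx
    rw [Set.indicator_apply, joint_apply]
    split_ifs with _ hl
    · refine absurd ?_ hx
      subst hl
      exact Finset.mem_image.2 ⟨x.get, Finset.mem_univ _, List.ofFn_get x⟩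
    · rfl
    · rfl

/-- Two distributions that agree outside `E` are at distance at most the mass of `E`. -/
theorem tv_le_of_eq_off {T : ℕ} {Q : List Bool → ℝ} (h0 : ∀ x : Fin T → Bool, 0 ≤ Q (List.ofFn x))
    (h1 : ∑ x : Fin T → Bool, Q (List.ofFn x) = 1) (E : Set (List Bool)) [DecidablePred (· ∈ E)]
    (hE : ∀ x : Fin T → Bool, List.ofFn x ∉ E → Q (List.ofFn x) = P.prob (List.ofFn x)) :
    P.tv T Q ≤ ∑ x : Fin T → Bool, if List.ofFn x ∈ E then P.prob (List.ofFn x) else 0 := by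
  -- On `E` the bound is |p - q| ≤ p + q, written as 2p - (p - q); off `E` both sides are 0. After
  -- summation the terms p - q cancel, both total masses being 1.
  have key : ∑ x : Fin T → Bool, |P.prob (List.ofFn x) - Q (List.ofFn x)| ≤
      ∑ x : Fin T → Bool, (2 * (if List.ofFn x ∈ E then P.prob (List.ofFn x) else 0) -
        (P.prob (List.ofFn x) - Q (List.ofFn x))) := by
    refine Finset.sum_le_sum fun x _ => ?_
    split_ifs with hx
    · rw [abs_le]
      constructor <;> linarith [h0 x, P.prob_nonneg (List.ofFn x)]
    · simp [hE x hx]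
  rw [Finset.sum_sub_distrib, Finset.sum_sub_distrib, ← Finset.mul_sum, h1, P.sum_prob] at key
  rw [tv]
  linarith

end SeqDist

/-! ### Exact predictions -/

namespace ExactLearner

open Prog LinAlg Finset

/-- The cell at time `t`. -/
def cell (cells : List Cell) (t : ℕ) : Cell := cells.getD t ⟨[], []⟩

/-- The value of `condRow`. -/
noncomputable def condVec (P : SeqDist) (f : List Bool) (B : List (List Bool)) : List ℝ :=
  B.map fun b => P.cond b f

/-- The value of `push`. -/
def pushVec : List (List (List ℝ) × List (List ℝ)) → List Bool → List ℝ → List ℝ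
  | A :: ops, o :: x, v => pushVec ops x ((pick A o).map fun row => ldot row v)
  | _, _, v => v

theorem pushVec_nil (ops : List (List (List ℝ) × List (List ℝ))) (v : List ℝ) :
    pushVec ops [] v = v := by
  cases ops <;> rfl

/-- `pushVec` consumes the sequence from the front, whereas predictions are compared when an
observation is appended at the end. -/
theorem pushVec_append_singleton (o : Bool) :
    ∀ (ops : List (List (List ℝ) × List (List ℝ))) (y : List Bool) (v : List ℝ),
      y.length < ops.length → pushVec ops (y ++ [o]) v =
        (pick (ops.getD y.length ([], [])) o).map fun row => ldot row (pushVec ops y v)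
  | [], y, v, h => by simp at h
  | A :: ops, [], v, _ => by
    rw [List.nil_append, pushVec, pushVec_nil, pushVec_nil]
    rfl
  | A :: ops, a :: y, v, h => by
    rw [List.cons_append, pushVec, pushVec_append_singleton o ops y _ (by simpa using h), pushVec]
    rfl

/-- The histories and tests of time `t` are well formed, and `Pr[Λ_t | B_t]` is a nonsingular
square matrix. -/
structure CellOK (P : SeqDist) (T t : ℕ) (c : Cell) : Prop where
  hist_length : ∀ h ∈ c.hist, h.length = t
  test_length : ∀ f ∈ c.test, t + f.length ≤ T
  square : c.test.length = c.hist.length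
  head : t < T → ∃ z ts, c.test = [z] :: ts
  nonsing : ∀ v : ℕ → ℝ, (∀ f ∈ c.test,
    ∑ i ∈ range c.hist.length, P.cond (c.hist.getD i []) f * v i = 0) →
      ∀ i < c.hist.length, v i = 0

/-- A linear relation among the full columns of these histories restricts to the rows in the test
set, where nonsingularity makes it trivial. The columns are thus independent. -/
theorem CellOK.length_le_rank {P : SeqDist} {T t r : ℕ} {c : Cell} (h : CellOK P T t c)
    (hP : P.HasRank T r) (h1 : 1 ≤ t) (hT : t ≤ T) : c.hist.length ≤ r := by
  refine le_trans ?_ (hP t h1 hT)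
  have hlen : ∀ i : Fin c.hist.length, (c.hist.get i).length = t :=
    fun i => h.hist_length _ (List.get_mem _ _)
  have hx : ∀ i : Fin c.hist.length, ∃ x : Fin t → Bool, List.ofFn x = c.hist.get i := fun i => by
    have := hlen i
    generalize c.hist.get i = l at this
    subst this
    exact ⟨l.get, List.ofFn_get l⟩
  choose x hx using hx
  rw [Matrix.rank_eq_finrank_span_cols]
  let w : Fin c.hist.length → Submodule.span ℝ (Set.range (P.condMatrix T t).col) :=
    fun i => ⟨(P.condMatrix T t).col (x i), Submodule.subset_span ⟨x i, rfl⟩⟩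
  have hw : LinearIndependent ℝ w := by
    rw [Fintype.linearIndependent_iff]
    intro g hg i
    have key := h.nonsing (fun i => if hi : i < c.hist.length then g ⟨i, hi⟩ else 0) ?_ i i.2
    · simpa using key
    intro f hf
    have h1 := congrArg Subtype.val hg
    have h2 := congrFun h1 ⟨f, h.test_length f hf⟩
    rw [Submodule.coe_sum, Finset.sum_apply] at h2
    rw [← Fin.sum_univ_eq_sum_range (fun i => P.cond (c.hist.getD i []) f *
      if hi : i < c.hist.length then g ⟨i, hi⟩ else 0)]
    refine Eq.trans (sum_congr rfl fun i _ => ?_) h2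
    show _ = g i * P.cond (List.ofFn (x i)) f
    rw [hx]
    simp [mul_comm]
  have : FiniteDimensional ℝ (Submodule.span ℝ (Set.range (P.condMatrix T t).col)) :=
    FiniteDimensional.span_of_finite ℝ (Set.finite_range _)
  simpa using hw.fintype_card_le_finrank

/-- An injective endomorphism of a finite-dimensional space is surjective. This supplies the
consistency that Gaussian elimination requires. -/
theorem CellOK.exists_solution {P : SeqDist} {T t : ℕ} {c : Cell} (h : CellOK P T t c)
    (b : List Bool → ℝ) : ∃ v : ℕ → ℝ, ∀ f ∈ c.test,
      ∑ i ∈ range c.hist.length, P.cond (c.hist.getD i []) f * v i = b f := by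
  let k := c.hist.length
  let M : Matrix (Fin k) (Fin k) ℝ :=
    Matrix.of fun i j => P.cond (c.hist.getD j []) (c.test.getD i [])
  have hM : ∀ (v : ℕ → ℝ) (i : Fin k), Matrix.mulVec M (fun j : Fin k => v j) i =
      ∑ j ∈ range k, P.cond (c.hist.getD j []) (c.test.getD i []) * v j := fun v i =>
    Fin.sum_univ_eq_sum_range (fun j => P.cond (c.hist.getD j []) (c.test.getD i []) * v j) k
  have hmem : ∀ f ∈ c.test, ∃ i : Fin k, c.test.getD i [] = f := fun f hf => by
    obtain ⟨i, hi, rfl⟩ := List.getElem_of_mem hf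
    exact ⟨⟨i, hi.trans_eq h.square⟩, by simp [hi]⟩
  have hext : ∀ v : Fin k → ℝ, (fun j : Fin k => (fun i : ℕ => if hi : i < k then v ⟨i, hi⟩ else 0)
      (j : ℕ)) = v := fun v => by
    funext j
    simp
  have hinj : Function.Injective M.mulVecLin := by
    rw [← LinearMap.ker_eq_bot, LinearMap.ker_eq_bot']
    intro v hv
    funext j
    have := h.nonsing (fun i => if hi : i < k then v ⟨i, hi⟩ else 0) ?_ j j.2
    · simpa using this
    intro f hf
    obtain ⟨i, rfl⟩ := hmem f hf
    rw [← hM _ i, hext v]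
    exact congrFun hv i
  obtain ⟨v, hv⟩ := LinearMap.injective_iff_surjective.1 hinj fun i => b (c.test.getD i [])
  refine ⟨fun i => if hi : i < k then v ⟨i, hi⟩ else 0, fun f hf => ?_⟩
  obtain ⟨i, rfl⟩ := hmem f hf
  rw [← hM _ i, hext v]
  exact congrFun hv i

/-- The invariant of the main loop. -/
structure Inv (P : SeqDist) (T : ℕ) (cells : List Cell) : Prop where
  length_eq : cells.length = T + 1
  hist_zero : (cell cells 0).hist = [[]]
  cellOK : ∀ t ≤ T, CellOK P T t (cell cells t)

/-- The operators solve the linear systems that define them. -/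
structure OpsOK (P : SeqDist) (T : ℕ) (cells : List Cell)
    (ops : List (List (List ℝ) × List (List ℝ))) : Prop where
  length_eq : ops.length = T
  op_length : ∀ t < T, ∀ o, (pick (ops.getD t ([], [])) o).length = (cell cells (t + 1)).hist.length
  row_length : ∀ t < T, ∀ o, ∀ row ∈ pick (ops.getD t ([], [])) o,
    row.length = (cell cells t).hist.length
  solves : ∀ t < T, ∀ o, ∀ l ∈ (cell cells (t + 1)).test, ∀ j < (cell cells t).hist.length,
    ∑ i ∈ range (cell cells (t + 1)).hist.length, P.cond ((cell cells (t + 1)).hist.getD i []) l *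
      ((pick (ops.getD t ([], [])) o).getD i []).getD j 0 =
        P.cond ((cell cells t).hist.getD j []) (o :: l)

/-- The prediction for the sequence `x` followed by the test `l`. -/
noncomputable def pred (P : SeqDist) (cells : List Cell)
    (ops : List (List (List ℝ) × List (List ℝ))) (x l : List Bool) : ℝ :=
  ldot (condVec P l (cell cells x.length).hist) (pushVec ops x [1])

/-- The predictions for `x` followed by the tests are correct. -/
def Good (P : SeqDist) (cells : List Cell) (ops : List (List (List ℝ) × List (List ℝ)))
    (x : List Bool) : Prop :=
  ∀ l ∈ (cell cells x.length).test, pred P cells ops x l = P.prob (x ++ l)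

variable {P : SeqDist} {T : ℕ} {cells : List Cell} {ops : List (List (List ℝ) × List (List ℝ))}

/-- The only history at time 0 is the empty one, with coefficient 1, so the prediction is Pr[l]
itself. -/
theorem good_nil (hI : Inv P T cells) : Good P cells ops [] := by
  intro l _
  simp [pred, hI.hist_zero, pushVec_nil, condVec, ldot, SeqDist.prob]

theorem length_pushVec (hI : Inv P T cells) (hO : OpsOK P T cells ops) (y : List Bool)
    (hy : y.length ≤ T) : (pushVec ops y [1]).length = (cell cells y.length).hist.length := by
  induction y using List.reverseRecOn with
  | nil => simp [pushVec_nil, hI.hist_zero]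
  | append_singleton y o _ =>
    have hy' : y.length < T := by simpa using hy
    rw [pushVec_append_singleton o ops y _ (by rwa [hO.length_eq]), List.length_map,
      hO.op_length _ hy', List.length_append, List.length_singleton]

theorem ldot_condVec (B : List (List Bool)) (f : List Bool) (v : List ℝ) (h : v.length = B.length) :
    ldot (condVec P f B) v = ∑ i ∈ range B.length, P.cond (B.getD i []) f * v.getD i 0 := by
  rw [ldot_eq_sum _ _ _ h.le]
  refine sum_congr rfl fun i hi => ?_
  have hi := mem_range.1 hi
  simp [condVec, hi]

/-- The system solved by the operator moves it from the state to the test: a prediction after one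
more observation `o` is the old state tested on the longer future `o :: l`. -/
theorem pred_append_singleton (hI : Inv P T cells) (hO : OpsOK P T cells ops) (y : List Bool)
    (hy : y.length < T) (o : Bool) (l : List Bool) (hl : l ∈ (cell cells (y.length + 1)).test) :
    pred P cells ops (y ++ [o]) l =
      ldot (condVec P (o :: l) (cell cells y.length).hist) (pushVec ops y [1]) := by
  have hlen := length_pushVec hI hO y hy.le
  have hAl := hO.op_length _ hy o
  rw [pred, List.length_append, List.length_singleton,
    pushVec_append_singleton o ops y _ (by rwa [hO.length_eq]),
    ldot_condVec _ _ _ (by rw [List.length_map, hAl]), ldot_condVec _ _ _ hlen]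
  have hR : ∀ j ∈ range (cell cells y.length).hist.length,
      P.cond ((cell cells y.length).hist.getD j []) (o :: l) * (pushVec ops y [1]).getD j 0 =
        ∑ i ∈ range (cell cells (y.length + 1)).hist.length,
          P.cond ((cell cells (y.length + 1)).hist.getD i []) l *
            ((pick (ops.getD y.length ([], [])) o).getD i []).getD j 0 *
              (pushVec ops y [1]).getD j 0 := fun j hj => by
    rw [← hO.solves _ hy o l hl j (mem_range.1 hj), sum_mul]
  -- Associativity of row times matrix times vector, as an exchange of sums.
  rw [sum_congr rfl hR, sum_comm]
  refine sum_congr rfl fun i hi => ?_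
  have hi : i < (pick (ops.getD y.length ([], [])) o).length := by rw [hAl]; exact mem_range.1 hi
  have hmap : ((pick (ops.getD y.length ([], [])) o).map
      fun row => ldot row (pushVec ops y [1])).getD i 0 =
        ldot ((pick (ops.getD y.length ([], [])) o).getD i []) (pushVec ops y [1]) := by
    rw [List.getD_eq_getElem _ _ (by simpa using hi), List.getD_eq_getElem _ _ hi, List.getElem_map]
  rw [hmap, ldot_eq_sum _ _ _ hlen.le, mul_sum]
  simp only [mul_assoc]

/-- One step from the empty history is exact by the operator equation. Hence a first error never
occurs at length one, B_0 stays {φ}, and no rank bound at time 0 is needed. -/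
theorem good_singleton (hI : Inv P T cells) (hO : OpsOK P T cells ops) (hT : 0 < T) (o : Bool) :
    Good P cells ops [o] := by
  intro l hl
  have := pred_append_singleton hI hO [] hT o l hl
  rw [List.nil_append] at this
  rw [this]
  simp [hI.hist_zero, pushVec_nil, condVec, ldot, SeqDist.prob]

/-- A wrong prediction one step after a correct one enlarges the nonsingular matrix. -/
theorem CellOK.extend (hI : Inv P T cells) (hO : OpsOK P T cells ops) (y : List Bool)
    (hy : y.length < T) (hpos : 0 < P.prob y) (hgood : Good P cells ops y) (o : Bool)
    (l : List Bool) (hl : l ∈ (cell cells (y.length + 1)).test)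
    (hbad : pred P cells ops (y ++ [o]) l ≠ P.prob (y ++ [o] ++ l)) :
    CellOK P T y.length ⟨(cell cells y.length).hist ++ [y],
      (cell cells y.length).test ++ [o :: l]⟩ := by
  have hc := hI.cellOK _ hy.le
  have hlen := length_pushVec hI hO y hy.le
  set c := cell cells y.length with hcdef
  set v₀ := pushVec ops y [1] with hv₀
  refine ⟨?_, ?_, ?_, ?_, ?_⟩
  · intro h hh
    rcases List.mem_append.1 hh with hh | hh
    · exact hc.hist_length h hh
    · rw [List.mem_singleton.1 hh]
  · intro f hf
    rcases List.mem_append.1 hf with hf | hf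
    · exact hc.test_length f hf
    · rw [List.mem_singleton.1 hf, List.length_cons]
      have := (hI.cellOK _ hy).test_length l hl
      omega
  · simp [hc.square]
  · intro _
    obtain ⟨z, ts, h⟩ := hc.head hy
    exact ⟨z, ts ++ [o :: l], by simp [h]⟩
  · intro v hv
    have hsum : ∀ f, ∑ i ∈ range (c.hist ++ [y]).length, P.cond ((c.hist ++ [y]).getD i []) f * v i =
        ∑ i ∈ range c.hist.length, P.cond (c.hist.getD i []) f * v i +
          P.cond y f * v c.hist.length := by
      intro f
      rw [List.length_append, List.length_singleton, sum_range_succ]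
      congr 1
      · refine sum_congr rfl fun i hi => ?_
        rw [List.getD_append _ _ _ _ (mem_range.1 hi)]
      · rw [List.getD_append_right _ _ _ _ le_rfl]
        simp
    simp only [hsum] at hv
    -- Let k be the old size. On old tests the old matrix sends `v` to -v_k Pr[f | y], and it sends
    -- `v₀` to Pr[y] Pr[f | y] because y is good. So Pr[y] v + v_k v₀ lies in its kernel.
    have hker : ∀ i < c.hist.length, P.prob y * v i + v c.hist.length * v₀.getD i 0 = 0 := by
      refine hc.nonsing (fun i => P.prob y * v i + v c.hist.length * v₀.getD i 0) fun f hf => ?_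
      have h1 := hv f (List.mem_append_left _ hf)
      have h2 := hgood f hf
      rw [pred, ldot_condVec _ _ _ hlen, SeqDist.prob_append] at h2
      have e : ∀ i, P.cond (c.hist.getD i []) f * (P.prob y * v i + v c.hist.length * v₀.getD i 0)
          = P.prob y * (P.cond (c.hist.getD i []) f * v i) +
            v c.hist.length * (P.cond (c.hist.getD i []) f * v₀.getD i 0) := fun i => by ring
      simp only [e, sum_add_distrib, ← mul_sum]
      linear_combination P.prob y * h1 + v c.hist.length * h2
    -- Eliminating v_i from the new row leaves v_k times the difference between the true and the
    -- predicted value of Pr[y o l], which is nonzero by `hbad`.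
    have hlast : v c.hist.length = 0 := by
      have h1 := hv (o :: l) (by simp)
      rw [pred_append_singleton hI hO y hy o l hl, ldot_condVec _ _ _ hlen, List.append_assoc,
        List.singleton_append, SeqDist.prob_append] at hbad
      have e : P.prob y * ∑ i ∈ range c.hist.length, P.cond (c.hist.getD i []) (o :: l) * v i =
          - (v c.hist.length *
            ∑ i ∈ range c.hist.length, P.cond (c.hist.getD i []) (o :: l) * v₀.getD i 0) := by
        rw [mul_sum, mul_sum, ← sum_neg_distrib]
        refine sum_congr rfl fun i hi => ?_
        linear_combination P.cond (c.hist.getD i []) (o :: l) * hker i (mem_range.1 hi)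
      by_contra hne
      refine hbad (mul_left_cancel₀ hne ?_)
      linear_combination e - P.prob y * h1
    intro i hi
    rw [List.length_append, List.length_singleton] at hi
    rcases Nat.lt_succ_iff_lt_or_eq.1 hi with hi | rfl
    · have := hker i hi
      rw [hlast, zero_mul, add_zero] at this
      exact (mul_eq_zero.1 this).resolve_left hpos.ne'
    · exact hlast

end ExactLearner

/-! ### The steps of a round -/

namespace ExactLearner

open Prog LinAlg Finset

/-! ### Step bounds, as expressions over an arbitrary commutative semiring -/

section Costs

variable {S : Type*} [CommSemiring S]

/-- The cost of `operator` for sequence length `T` and at most `K` histories at each time. -/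
def operatorCost (T K : S) : S :=
  (T + 1) + (T + 1) + K * (2 * (K * (T + 2)) + 1) + 2 * K + K * pivotCost K

/-- The cost of `check`. -/
def checkCost (T K : S) : S :=
  (T + 1) + 1 + T * (K * (2 * K + 2)) + K * (K * (T + 2) + (2 * K + 1) + (1 + T) + 1 + 1)

/-- The cost of `sampleAll` with `n` samples of each length. -/
def sampleCost (T n : S) : S := T * (n * (1 + T + 1) + 1) + T * n

/-- The cost of the part of a round that follows the sampling. -/
def searchCost (T K n : S) : S :=
  T * n * (checkCost T K + 1) + T * (T + 1 + K * (T + 2) + 1) + T * (T + checkCost T K + 1) +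
    (2 * T + (T + 1) + (T + 1) * K)

/-- The cost of a round. -/
def roundCost (T K n : S) : S :=
  T * (2 * operatorCost T K + 1) + sampleCost T n + searchCost T K n

end Costs

variable {P : SeqDist} {T K : ℕ} {cells : List Cell} {ops : List (List (List ℝ) × List (List ℝ))}

theorem sat_cellAt {t : ℕ} (ht : t ≤ T) :
    Sat P T (cellAt cells t : Prog ℝ True Cell) (T + 1) (· = cell cells t) :=
  Sat.le (p := cellAt cells t) ((sat_tick (t + 1)).bind (B₂ := 0) fun _ _ => Sat.pure rfl)
    (by omega)

theorem sat_condRow {f : List Bool} {B : List (List Bool)} (h : ∀ b ∈ B, b.length + f.length ≤ T) :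
    Sat P T (condRow f B) (B.length * (T + 2)) (· = condVec P f B) :=
  (sat_forEach_map fun b hb => sat_askCond (h b hb)).le (by rw [show 1 + T + 1 = T + 2 by omega])

theorem getD_condVec (f : List Bool) (B : List (List Bool)) (i : ℕ) (hi : i < B.length) :
    (condVec P f B).getD i 0 = P.cond (B.getD i []) f := by
  simp [condVec, hi]

theorem sat_operator (hI : Inv P T cells) (hK : ∀ t ≤ T, (cell cells t).hist.length ≤ K) {t : ℕ}
    (ht : t < T) (o : Bool) :
    Sat P T (operator cells t o) (operatorCost T K) fun A =>
      A.length = (cell cells (t + 1)).hist.length ∧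
      (∀ row ∈ A, row.length = (cell cells t).hist.length) ∧
      ∀ l ∈ (cell cells (t + 1)).test, ∀ j < (cell cells t).hist.length,
        ∑ i ∈ range (cell cells (t + 1)).hist.length,
          P.cond ((cell cells (t + 1)).hist.getD i []) l * (A.getD i []).getD j 0 =
            P.cond ((cell cells t).hist.getD j []) (o :: l) := by
  have hcur := hI.cellOK t ht.le
  have hnxt := hI.cellOK (t + 1) ht
  have hk := hK t ht.le
  have hk' := hK (t + 1) ht
  rw [operator]
  refine ((sat_cellAt ht.le).bind fun cur h1 => (sat_cellAt (t := t + 1) ht).bind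
    (B₂ := K * (2 * (K * (T + 2)) + 1) + (2 * K + K * pivotCost K)) fun nxt h2 => ?_).le
      (by simp only [operatorCost]; omega)
  subst h1 h2
  have hrows : K * (T + 2) + (K * (T + 2) + 0) = 2 * (K * (T + 2)) := by omega
  refine (((sat_forEach_map (B := 2 * (K * (T + 2))) (f := fun l =>
    (condVec P l (cell cells (t + 1)).hist, condVec P (o :: l) (cell cells t).hist))
      fun l hl => ?_).le ?_).bind fun rows hrows => ((sat_tick _).le ?_).bind fun _ _ => ?_)
  · have hl' := hnxt.test_length l hl
    refine (((sat_condRow fun b hb => ?_).le (Nat.mul_le_mul_right _ hk')).bind fun lhs h1 =>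
      ((sat_condRow fun b hb => ?_).le (Nat.mul_le_mul_right _ hk)).bind (B₂ := 0) fun rhs h2 =>
        Sat.pure ?_).le hrows.le
    · rw [hnxt.hist_length b hb]; omega
    · rw [hcur.hist_length b hb, List.length_cons]; omega
    · rw [h1, h2]
  · exact Nat.mul_le_mul_right _ (hnxt.square.trans_le hk')
  · omega
  · subst hrows
    -- One exact solution for each history in B_t: the columns of an operator, witnessing
    -- consistency.
    choose Y hY using fun j => hnxt.exists_solution fun f => P.cond ((cell cells t).hist.getD j [])
      (o :: f)
    refine ((sat_solve hk (cell cells (t + 1)).hist.length _ hk' ?_ ?_ ⟨fun i j => Y j i, ?_⟩).imp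
      fun A hA => ⟨hA.1, hA.2.1, fun l hl j hj => ?_⟩).le (Nat.mul_le_mul_right _ hk')
    · rw [List.length_map]
      exact hnxt.square.trans_le hk'
    · intro row hrow
      obtain ⟨l, _, rfl⟩ := List.mem_map.1 hrow
      simp [condVec]
    · intro row hrow j hj
      obtain ⟨l, hl, rfl⟩ := List.mem_map.1 hrow
      simp only
      rw [getD_condVec _ _ _ hj, ← hY j l hl]
      exact sum_congr rfl fun i hi => by rw [getD_condVec _ _ _ (mem_range.1 hi)]
    · have := hA.2.2 _ (List.mem_map_of_mem hl) j hj
      simp only at this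
      rw [getD_condVec _ _ _ hj] at this
      rw [← this]
      exact sum_congr rfl fun i hi => by rw [getD_condVec _ _ _ (mem_range.1 hi)]

theorem forall₂_range {α : Type} {R : ℕ → α → Prop} {as : List α} (d : α)
    (h : List.Forall₂ R (List.range T) as) : as.length = T ∧ ∀ t < T, R t (as.getD t d) := by
  rw [List.forall₂_iff_get] at h
  have hl : as.length = T := by simpa using h.1.symm
  refine ⟨hl, fun t ht => ?_⟩
  have := h.2 t (by simpa using ht) (by omega)
  rw [List.getD_eq_getElem _ _ (by omega)]
  simpa using this

theorem sat_operators (hI : Inv P T cells) (hK : ∀ t ≤ T, (cell cells t).hist.length ≤ K) :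
    Sat P T (operators cells T) (T * (2 * operatorCost T K + 1)) (OpsOK P T cells) := by
  rw [operators]
  refine (sat_forEach (B := 2 * operatorCost T K) (R := fun t A =>
      ∀ o, (pick A o).length = (cell cells (t + 1)).hist.length ∧
      (∀ row ∈ pick A o, row.length = (cell cells t).hist.length) ∧
      ∀ l ∈ (cell cells (t + 1)).test, ∀ j < (cell cells t).hist.length,
        ∑ i ∈ range (cell cells (t + 1)).hist.length,
          P.cond ((cell cells (t + 1)).hist.getD i []) l * ((pick A o).getD i []).getD j 0 =
            P.cond ((cell cells t).hist.getD j []) (o :: l)) fun t ht => ?_).mono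
      (by rw [List.length_range]) fun as has => ?_
  · have ht := List.mem_range.1 ht
    refine ((sat_operator hI hK ht false).bind fun A0 h0 => (sat_operator hI hK ht true).bind
      (B₂ := 0) fun A1 h1 => Sat.pure fun o => ?_).le (by omega)
    cases o
    · exact h0
    · exact h1
  · obtain ⟨h1, h2⟩ := forall₂_range ([], []) has
    exact ⟨h1, fun t ht o => (h2 t ht o).1, fun t ht o => (h2 t ht o).2.1,
      fun t ht o => (h2 t ht o).2.2⟩

theorem OpsOK.pick_length_le (hO : OpsOK P T cells ops)
    (hK : ∀ t ≤ T, (cell cells t).hist.length ≤ K) : ∀ A ∈ ops, ∀ o, (pick A o).length ≤ K := by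
  intro A hA o
  obtain ⟨t, ht, rfl⟩ := List.getElem_of_mem hA
  have ht' : t < T := by rwa [← hO.length_eq]
  have := hO.op_length t ht' o
  rw [List.getD_eq_getElem _ _ ht] at this
  exact this.trans_le (hK _ ht')

theorem sat_push : ∀ (ops : List (List (List ℝ) × List (List ℝ))) (x : List Bool) (v : List ℝ),
    (∀ A ∈ ops, ∀ o, (pick A o).length ≤ K) → v.length ≤ K →
    Sat P T (push ops x v : Prog ℝ True (List ℝ)) (x.length * (K * (2 * K + 2)))
      (· = pushVec ops x v)
  | A :: ops, o :: x, v, hA, hv => by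
    rw [push]
    refine (((sat_matVec (pick A o) v).le (Nat.mul_le_mul (hA A (by simp) o)
      (show 2 * v.length + 2 ≤ 2 * K + 2 by omega))).bind fun w hw => (sat_push ops x w
        (fun A h => hA A (by simp [h])) ?_).imp fun u hu => ?_).le ?_
    · rw [hw, List.length_map]
      exact hA A (by simp) o
    · rw [hu, hw]; rfl
    · rw [List.length_cons, Nat.succ_mul x.length]; omega
  | [], x, v, _, _ => by
    rw [push]
    · exact (Sat.pure (by simp [pushVec])).le (by omega)
    · simp
  | A :: ops, [], v, _, _ => by
    rw [push]
    · exact (Sat.pure (by simp [pushVec])).le (by omega)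
    · simp

theorem sat_check (hI : Inv P T cells) (hO : OpsOK P T cells ops)
    (hK : ∀ t ≤ T, (cell cells t).hist.length ≤ K) {x : List Bool} (hx : x.length ≤ T) :
    Sat P T (check ops cells x) (checkCost T K) fun o =>
      (o = none → Good P cells ops x) ∧ ∀ l, o = some l →
        l ∈ (cell cells x.length).test ∧ pred P cells ops x l ≠ P.prob (x ++ l) := by
  have hc := hI.cellOK _ hx
  have hk := hK _ hx
  -- The initial vector `[1]` has length one and must also fit into the bound `K`.
  have h1K : 1 ≤ K := le_trans (by simp [hI.hist_zero]) (hK 0 (Nat.zero_le _))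
  have hv : (pushVec ops x [1]).length ≤ K := (length_pushVec hI hO x hx).trans_le hk
  rw [check]
  refine ((sat_cellAt hx).bind fun c h1 => (sat_one).bind fun u h2 =>
    ((sat_push (K := K) ops x [u] (hO.pick_length_le hK) (by simpa using h1K)).le
      (Nat.mul_le_mul_right _ hx)).bind
    (B₂ := K * (K * (T + 2) + (2 * K + 1) + (1 + T) + 1 + 1)) fun v h3 => ?_).le
      (by simp only [checkCost]; omega)
  subst h1 h2 h3
  refine (sat_findFirst (B := K * (T + 2) + (2 * K + 1) + (1 + T) + 1)
    (N := fun l => pred P cells ops x l = P.prob (x ++ l))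
    (S := fun l c => c = l ∧ pred P cells ops x l ≠ P.prob (x ++ l)) fun l hl => ?_).mono
      (Nat.mul_le_mul_right _ (hc.square.trans_le hk)) fun o ho => ⟨ho.1, fun l hl => ?_⟩
  · have hl' := hc.test_length l hl
    refine (((sat_condRow fun b hb => ?_).le (Nat.mul_le_mul_right _ hk)).bind fun row h1 =>
      ((sat_dot _ _).le (show _ ≤ 2 * K + 1 by omega)).bind fun p h2 =>
        (sat_askCond ?_).bind fun q h3 => (sat_isEq _ _).bind (B₂ := 0) fun same h4 =>
          Sat.pure ?_).le (by omega)
    · rw [hc.hist_length b hb]; omega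
    · simpa using hl'
    · subst h1 h2 h3 h4
      have : (ldot (condVec P l (cell cells x.length).hist) (pushVec ops x [1]) =
        P.cond [] (x ++ l)) ↔ pred P cells ops x l = P.prob (x ++ l) := Iff.rfl
      by_cases h : pred P cells ops x l = P.prob (x ++ l)
      · simp [this, h]
      · simp [this, h]
  · obtain ⟨l₁, b, l₂, h1, _, rfl, h2⟩ := ho.2 l hl
    exact ⟨by rw [h1]; simp, h2⟩

theorem sat_locate (hI : Inv P T cells) (hO : OpsOK P T cells ops)
    (hK : ∀ t ≤ T, (cell cells t).hist.length ≤ K) {x : List Bool} (hx : x.length ≤ T)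
    (hbad : ¬ Good P cells ops x) :
    Sat P T (locate ops cells x) (T * (T + checkCost T K + 1)) fun o =>
      ∃ s l, o = some (s + 1, l) ∧ s < x.length ∧ Good P cells ops (x.take s) ∧
        l ∈ (cell cells (s + 1)).test ∧
        pred P cells ops (x.take (s + 1)) l ≠ P.prob (x.take (s + 1) ++ l) := by
  have hx0 : 0 < x.length := by
    rw [List.length_pos_iff]
    rintro rfl
    exact hbad (good_nil hI)
  rw [locate]
  refine (sat_findFirst (B := T + checkCost T K)
    (N := fun s => Good P cells ops (x.take s))
    (S := fun s c => c.1 = s ∧ c.2 ∈ (cell cells s).test ∧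
      pred P cells ops (x.take s) c.2 ≠ P.prob (x.take s ++ c.2)) fun s hs => ?_).mono
      (Nat.mul_le_mul_right _ (by simpa using hx)) fun o ho => ?_
  · have hs := List.mem_range'_1.1 hs
    have hsl : (x.take s).length = s := by rw [List.length_take]; omega
    refine ((sat_tick s).bind fun _ _ => (sat_check hI hO hK (hsl.trans_le (by omega))).bind
      (B₂ := 0) fun o ho => ?_).le (by omega)
    rw [hsl] at ho
    match o, ho with
    | none, ho => exact Sat.pure ⟨fun _ => ho.1 rfl, by simp⟩
    | some l, ho =>
      refine Sat.pure ⟨by simp, fun c hc => ?_⟩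
      obtain rfl := Option.some.inj hc
      exact ⟨rfl, ho.2 l rfl⟩
  · match o, ho with
    | none, ho =>
      -- The last length inspected is that of `x` itself, which is bad, so the search cannot come
      -- back empty.
      refine absurd (ho.1 rfl x.length (List.mem_range'_1.2 (by omega))) ?_
      rwa [List.take_length]
    | some (s, l), ho =>
      obtain ⟨l₁, b, l₂, h1, h2, rfl, h3⟩ := ho.2 _ rfl
      have hbmem : s ∈ List.range' 1 x.length := by rw [h1]; simp
      have hs := List.mem_range'_1.1 hbmem
      obtain ⟨s, rfl⟩ : ∃ s', s = s' + 1 := ⟨s - 1, by omega⟩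
      refine ⟨s, l, rfl, by omega, ?_, h3⟩
      -- Length 0 is outside the searched range but always good; a positive `s` precedes the hit `s
      -- + 1` in the increasing range, hence lies in the clean segment `l₁`.
      rcases Nat.eq_zero_or_pos s with rfl | hs0
      · rw [List.take_zero]
        exact good_nil hI
      · refine h2 s ?_
        have hsm : s ∈ List.range' 1 x.length := List.mem_range'_1.2 (by omega)
        have hsort : (List.range' 1 x.length).Pairwise (· < ·) := List.pairwise_lt_range'
        rw [h1, List.pairwise_append, List.pairwise_cons] at hsort
        rw [h1, List.mem_append, List.mem_cons] at hsm
        rcases hsm with h | h | h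
        · exact h
        · omega
        · have := hsort.2.1.1 s h
          omega

/-- The sequence is short enough and all its prefixes have positive probability. -/
def IsSamplePrefix (P : SeqDist) (T : ℕ) (x : List Bool) : Prop :=
  x.length ≤ T ∧ ∀ s, 0 < P.prob (x.take s)

theorem forall₂_const {α β : Type} {p : α → Prop} {l : List β} {as : List α}
    (h : List.Forall₂ (fun _ a => p a) l as) : as.length = l.length ∧ ∀ a ∈ as, p a := by
  induction h with
  | nil => simp
  | cons h _ ih => exact ⟨by simp [ih.1], List.forall_mem_cons.2 ⟨h, ih.2⟩⟩

theorem sat_sampleAll (n : ℕ) : Sat P T (sampleAll T n) (sampleCost T n) fun xs =>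
    xs.length = T * n ∧ ∀ x ∈ xs, IsSamplePrefix P T x := by
  rw [sampleAll]
  refine ((sat_forEach (B := n * (1 + T + 1)) (R := fun _ (b : List (List Bool)) =>
    b.length = n ∧ ∀ x ∈ b, IsSamplePrefix P T x) fun t ht => ?_).bind fun blocks hb =>
      (sat_tick _).bind (B₂ := 0) fun _ _ => Sat.pure ?_).le
      (by simp only [sampleCost, List.length_range']; omega)
  · have ht := List.mem_range'_1.1 ht
    refine (sat_forEach (B := 1 + T) (R := fun _ x => IsSamplePrefix P T x) fun i _ =>
      (sat_draw.bind (B₂ := 0) fun x hx => Sat.pure ⟨?_, fun s => ?_⟩)).mono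
        (by rw [List.length_range]) fun b hb => ?_
    · rw [List.length_take, P.length_of_mem_support hx]
      omega
    · rw [List.take_take]
      exact P.prob_take_pos hx _
    · simpa using forall₂_const hb
  · have hb' : blocks.length = T ∧
        ∀ b ∈ blocks, b.length = n ∧ ∀ x ∈ b, IsSamplePrefix P T x := by
      simpa using forall₂_const hb
    refine ⟨?_, fun x hx => ?_⟩
    · rw [List.length_flatten, List.eq_replicate_of_mem (a := n) (l := blocks.map List.length)]
      · simp [hb'.1]
      · intro m hm
        obtain ⟨b, hb, rfl⟩ := List.mem_map.1 hm
        exact (hb'.2 b hb).1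
    · obtain ⟨b, hb, hxb⟩ := List.mem_flatten.1 hx
      exact (hb'.2 b hb).2 x hxb

/-- The value of `testRows`. -/
noncomputable def testVec (P : SeqDist) (cells : List Cell) (t : ℕ) : Bool × List ℝ :=
  let z := ((cell cells t).test.headD []).headD false
  (z, condVec P [z] (cell cells t).hist)

theorem sat_testRows (hI : Inv P T cells) (hK : ∀ t ≤ T, (cell cells t).hist.length ≤ K) :
    Sat P T (testRows cells T) (T * (T + 1 + K * (T + 2) + 1))
      (· = (List.range T).map (testVec P cells)) := by
  rw [testRows]
  refine (sat_forEach_map (B := T + 1 + K * (T + 2)) fun t ht => ?_).le (by rw [List.length_range])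
  have ht := List.mem_range.1 ht
  refine ((sat_cellAt ht.le).bind fun c hc => ((sat_condRow fun b hb => ?_).le
    (Nat.mul_le_mul_right _ ((congrArg (fun c => c.hist.length) hc).trans_le (hK t ht.le)))).bind
      (B₂ := 0) fun row hrow => Sat.pure ?_).le (by omega)
  · subst hc
    rw [(hI.cellOK t ht.le).hist_length b hb, List.length_singleton]
    omega
  · subst hc hrow
    rfl

/-! ### The number of histories as a measure of progress -/

/-- The total number of histories. -/
def histCount (cells : List Cell) : ℕ := (cells.map fun c => c.hist.length).sum

theorem histCount_modify (f : Cell → Cell) (hf : ∀ c, (f c).hist.length = c.hist.length + 1) :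
    ∀ (cells : List Cell) (t : ℕ), t < cells.length →
      histCount (cells.modify t f) = histCount cells + 1
  | [], t, h => by simp at h
  | c :: cells, 0, _ => by simp [histCount, hf]; omega
  | c :: cells, t + 1, h => by
    have := histCount_modify f hf cells t (by simpa using h)
    simp only [histCount, List.modify_succ_cons, List.map_cons, List.sum_cons] at this ⊢
    omega

theorem histCount_le (hI : Inv P T cells) (hK : ∀ t ≤ T, (cell cells t).hist.length ≤ K) :
    histCount cells ≤ (T + 1) * K := by
  have := List.sum_le_card_nsmul (cells.map fun c => c.hist.length) K fun m hm => by
    obtain ⟨c, hc, rfl⟩ := List.mem_map.1 hm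
    obtain ⟨t, ht, rfl⟩ := List.getElem_of_mem hc
    have := hK t (by rw [hI.length_eq] at ht; omega)
    rwa [cell, List.getD_eq_getElem _ _ ht] at this
  simpa [histCount, hI.length_eq] using this

theorem cell_modify (f : Cell → Cell) (cells : List Cell) (t τ : ℕ) (hτ : τ < cells.length) :
    cell (cells.modify τ f) t = if t = τ then f (cell cells t) else cell cells t := by
  simp only [cell, List.getD_eq_getElem?_getD, List.getElem?_modify]
  by_cases h : t = τ
  · subst h
    simp [hτ]
  · simp [h, Ne.symm h]

theorem Inv.extend (hI : Inv P T cells) (hO : OpsOK P T cells ops) {x : List Bool}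
    (hx : IsSamplePrefix P T x) {s : ℕ} (hs : s < x.length) (hgood : Good P cells ops (x.take s))
    {l : List Bool} (hl : l ∈ (cell cells (s + 1)).test)
    (hbad : pred P cells ops (x.take (s + 1)) l ≠ P.prob (x.take (s + 1) ++ l)) :
    Inv P T (cells.modify s (ExactLearner.extend x s l)) := by
  have hsT : s < T := hs.trans_le hx.1
  have hsc : s < cells.length := by rw [hI.length_eq]; omega
  have hlen : (x.take s).length = s := by rw [List.length_take]; omega
  have htake : x.take (s + 1) = x.take s ++ [x.getD s false] := by
    rw [List.take_succ_eq_append_getElem hs, List.getD_eq_getElem _ _ hs]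
  rw [htake] at hbad
  -- The extended cell is not the one at time 0, so `hist_zero` is preserved.
  have hs0 : s ≠ 0 := by
    rintro rfl
    exact hbad (good_singleton hI hO hsT _ l hl)
  refine ⟨by rw [List.length_modify, hI.length_eq], ?_, fun t ht => ?_⟩
  · rw [cell_modify _ _ _ _ hsc, if_neg hs0.symm, hI.hist_zero]
  · rw [cell_modify _ _ _ _ hsc]
    split_ifs with h
    · subst h
      have := CellOK.extend hI hO (x.take t) (hlen.trans_lt hsT) (hx.2 t) hgood (x.getD t false) l
        (by rwa [hlen]) hbad
      rwa [hlen] at this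
    · exact hI.cellOK t ht

/-- The part of a round that follows the sampling. -/
def search (T : ℕ) (cells : List Cell) (ops : List (List (List ℝ) × List (List ℝ)))
    (xs : List (List Bool)) : Prog ℝ True (List Cell ⊕ Rep ℝ) := do
  let found ← findFirst (fun x => do
    match ← check ops cells x with
    | none => return none
    | some _ => return some x) xs
  match found with
  | none =>
    let tests ← testRows cells T
    return .inr ⟨ops, tests⟩
  | some x =>
    match ← locate ops cells x with
    | none => return .inl cells
    | some (s, l) =>
      tick (x.length + l.length + cells.length + (cells.map fun c => c.hist.length).sum)
      return .inl (cells.modify (s - 1) (extend x (s - 1) l))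

/-- Operators, samples and search are separated so that the failure analysis can fix the operators
before the samples are drawn. -/
theorem round_eq (T n : ℕ) (cells : List Cell) :
    (round T n cells : Prog ℝ True (List Cell ⊕ Rep ℝ)) =
      operators cells T >>= fun ops => sampleAll T n >>= fun xs => search T cells ops xs := rfl

/-- The returned representation consists of the operators and test rows of the cells. -/
structure RepOK (P : SeqDist) (T : ℕ) (cells : List Cell) (rep : Rep ℝ) : Prop where
  ops_ok : OpsOK P T cells rep.ops
  tests_eq : rep.tests = (List.range T).map (testVec P cells)

/-- The last conjunct drives the failure bound: a round can return only if every sampled prefix was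
good for the operators it returns. -/
theorem sat_search (hI : Inv P T cells) (hO : OpsOK P T cells ops)
    (hK : ∀ t ≤ T, (cell cells t).hist.length ≤ K) {n : ℕ} {xs : List (List Bool)}
    (hn : xs.length = T * n) (hxs : ∀ x ∈ xs, IsSamplePrefix P T x) :
    Sat P T (search T cells ops xs) (searchCost T K n) fun res =>
      (∀ cells', res = .inl cells' → Inv P T cells' ∧ histCount cells' = histCount cells + 1) ∧
      ∀ rep, res = .inr rep → rep.ops = ops ∧ RepOK P T cells rep ∧
        ∀ x ∈ xs, Good P cells ops x := by
  rw [search]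
  refine ((sat_findFirst (B := checkCost T K) (N := Good P cells ops)
    (S := fun x y => y = x ∧ ¬ Good P cells ops x) fun x hx => ?_).bind
    (B₂ := T * (T + 1 + K * (T + 2) + 1) + T * (T + checkCost T K + 1) +
      (2 * T + (T + 1) + (T + 1) * K)) fun found hf => ?_).le
    (by rw [hn]; simp only [searchCost]; omega)
  · refine ((sat_check hI hO hK (hxs x hx).1).bind (B₂ := 0) fun o ho => ?_)
    match o, ho with
    | none, ho => exact Sat.pure ⟨fun _ => ho.1 rfl, by simp⟩
    | some l, ho =>
      refine Sat.pure ⟨by simp, fun c hc => ?_⟩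
      obtain rfl := Option.some.inj hc
      exact ⟨rfl, fun h => (ho.2 l rfl).2 (h l (ho.2 l rfl).1)⟩
  · match found, hf with
    | none, hf =>
      refine ((sat_testRows hI hK).bind (B₂ := 0) fun tests ht => Sat.pure ⟨by simp, ?_⟩).le
        (by omega)
      intro rep hrep
      obtain rfl := Sum.inr.inj hrep
      exact ⟨rfl, ⟨hO, ht⟩, hf.1 rfl⟩
    | some x, hf =>
      obtain ⟨l₁, b, l₂, hl, _, rfl, hbad⟩ := hf.2 x rfl
      have hx : IsSamplePrefix P T x := hxs x (by rw [hl]; simp)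
      refine ((sat_locate hI hO hK hx.1 hbad).bind (B₂ := 2 * T + (T + 1) + (T + 1) * K)
        fun o ho => ?_).le (by omega)
      obtain ⟨s, l, rfl, hs, h1, h2, h3⟩ := ho
      have hsT : s < T := hs.trans_le hx.1
      refine ((sat_tick _).bind (B₂ := 0) fun _ _ => Sat.pure ⟨?_, by simp⟩).le ?_
      · have hH := histCount_le hI hK
        have hlT := (hI.cellOK _ hsT).test_length l h2
        have := hx.1
        rw [histCount] at hH
        rw [hI.length_eq]
        omega
      · intro cells' h
        obtain rfl := Sum.inl.inj h
        exact ⟨hI.extend hO hx hs h1 h2 h3, histCount_modify _ (fun c => by simp [extend]) _ _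
          (by rw [hI.length_eq]; omega)⟩

end ExactLearner

/-! ### Evaluation of the returned representation -/

namespace ExactLearner

open Prog LinAlg Finset

/-- The value of `clipRatio`. -/
noncomputable def clip (q p : ℝ) : ℝ :=
  if p = 0 then 0 else if q / p ≤ 0 then 0 else if 1 ≤ q / p then 1 else q / p

theorem clip_nonneg (q p : ℝ) : 0 ≤ clip q p := by
  unfold clip
  split_ifs <;> linarith

theorem clip_le_one (q p : ℝ) : clip q p ≤ 1 := by
  unfold clip
  split_ifs <;> linarith

/-- A ratio already in [0, 1] is unchanged by the projection; for p = 0 both sides vanish, so the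
default value is harmless. -/
theorem mul_clip {p c : ℝ} (h0 : 0 ≤ c) (h1 : c ≤ 1) : p * clip (p * c) p = p * c := by
  unfold clip
  split_ifs with hp h h'
  · simp [hp]
  · rw [mul_div_cancel_left₀ _ hp] at h
    rw [le_antisymm h h0]
  · rw [mul_div_cancel_left₀ _ hp] at h'
    rw [le_antisymm h1 h']
  · rw [mul_div_cancel_left₀ _ hp]

/-- The value of `evalFrom`. -/
noncomputable def evalVal : List (List (List ℝ) × List (List ℝ)) → List (Bool × List ℝ) →
    List Bool → List ℝ → ℝ → ℝ
  | A :: ops, (z, row) :: tests, o :: x, v, p =>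
    evalVal ops tests x ((pick A o).map fun row => ldot row v)
      (p * if o = z then clip (ldot row v) p else 1 - clip (ldot row v) p)
  | _, _, _, _, p => p

variable {P : SeqDist} {T K : ℕ} {cells : List Cell}

theorem sat_clipRatio {access : Prop} (q p : ℝ) :
    Sat P T (clipRatio q p : Prog ℝ access ℝ) 6 (· = clip q p) := by
  rw [clipRatio]
  refine (sat_zero).bind fun z hz => (sat_one).bind fun u hu => (sat_isEq p z).bind (B₂ := 3)
    fun b hb => ?_
  subst hz hu hb
  by_cases hp : p = 0
  · simp only [hp, decide_true, if_true]
    exact (Sat.pure (by simp [clip])).le (by omega)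
  · simp only [hp, decide_false, Bool.false_eq_true, if_false]
    refine (sat_div q p).bind fun c hc => (sat_isLe c 0).bind (B₂ := 1) fun b hb => ?_
    subst hc hb
    by_cases h0 : q / p ≤ 0
    · simp only [h0, decide_true, if_true]
      exact (Sat.pure (by simp [clip, h0])).le (by omega)
    · simp only [h0, decide_false, Bool.false_eq_true, if_false]
      refine (sat_isLe 1 (q / p)).bind (B₂ := 0) fun b hb => ?_
      subst hb
      by_cases h1 : 1 ≤ q / p
      · simp only [h1, decide_true, if_true]
        exact Sat.pure (by simp [clip, h0, h1, hp])
      · simp only [h1, decide_false, Bool.false_eq_true, if_false]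
        exact Sat.pure (by simp [clip, h0, h1, hp])

/-- The cost of evaluating one further observation. -/
def evalStepCost {S : Type*} [CommSemiring S] (K : S) : S := (2 * K + 1) + 9 + K * (2 * K + 2)

theorem sat_evalFrom : ∀ (ops : List (List (List ℝ) × List (List ℝ))) (tests : List (Bool × List ℝ))
    (x : List Bool) (v : List ℝ) (p : ℝ), (∀ A ∈ ops, ∀ o, (pick A o).length ≤ K) → v.length ≤ K →
      Sat P T (evalFrom ops tests x v p : Prog ℝ False ℝ) (x.length * evalStepCost K)
        (· = evalVal ops tests x v p)
  | A :: ops, (z, row) :: tests, o :: x, v, p, hA, hv => by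
    rw [evalFrom]
    refine (((sat_dot row v).le (show _ ≤ 2 * K + 1 by omega)).bind fun q hq =>
      (sat_clipRatio q p).bind fun c hc => (sat_one).bind fun u hu => (sat_sub u c).bind
      fun d hd => (sat_mul p _).bind fun p' hp' => ((sat_matVec (pick A o) v).le
        (Nat.mul_le_mul (hA A (by simp) o) (show 2 * v.length + 2 ≤ 2 * K + 2 by omega))).bind
      fun v' hv' => (sat_evalFrom ops tests x v' p' (fun A h => hA A (by simp [h])) ?_).imp
        fun e he => ?_).le ?_
    · rw [hv', List.length_map]
      exact hA A (by simp) o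
    · rw [he, hv', hp', hd, hu, hc, hq, evalVal]
    · rw [List.length_cons, Nat.succ_mul x.length]
      simp only [evalStepCost]
      omega
  | [], _, _, _, _, _, _ => by
    rw [evalFrom, evalVal]
    · exact (Sat.pure (Q := (· = _)) rfl).le (by omega)
    · simp
    · simp
  | _ :: _, [], _, _, _, _, _ => by
    rw [evalFrom, evalVal]
    · exact (Sat.pure (Q := (· = _)) rfl).le (by omega)
    · simp
    · simp
  | _ :: _, _ :: _, [], _, _, _, _ => by
    rw [evalFrom, evalVal]
    · exact (Sat.pure (Q := (· = _)) rfl).le (by omega)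
    · simp
    · simp

theorem evalVal_nonneg : ∀ (ops : List (List (List ℝ) × List (List ℝ)))
    (tests : List (Bool × List ℝ)) (x : List Bool) (v : List ℝ) (p : ℝ), 0 ≤ p →
      0 ≤ evalVal ops tests x v p
  | A :: ops, (z, row) :: tests, o :: x, v, p, hp => by
    rw [evalVal]
    refine evalVal_nonneg ops tests x _ _ (mul_nonneg hp ?_)
    split_ifs
    · exact clip_nonneg _ _
    · linarith [clip_le_one (ldot row v) p]
  | [], _, _, _, _, hp => by
    rw [evalVal]
    · exact hp
    · simp
  | _ :: _, [], _, _, _, hp => by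
    rw [evalVal]
    · exact hp
    · simp
  | _ :: _, _ :: _, [], _, _, hp => by
    rw [evalVal]
    · exact hp
    · simp

/-- The two continuations carry factors c and 1 - c, so mass is conserved at every step, whatever
the operators and rows are. -/
theorem sum_evalVal : ∀ (n : ℕ) (ops : List (List (List ℝ) × List (List ℝ)))
    (tests : List (Bool × List ℝ)) (v : List ℝ) (p : ℝ), ops.length = n → tests.length = n →
      ∑ x : Fin n → Bool, evalVal ops tests (List.ofFn x) v p = p
  | 0, [], [], v, p, _, _ => by simp [evalVal]
  | n + 1, A :: ops, (z, row) :: tests, v, p, h1, h2 => by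
    rw [SeqDist.sum_ofFn_succ n fun x => evalVal (A :: ops) ((z, row) :: tests) x v p]
    simp only [evalVal]
    rw [sum_evalVal n ops tests _ _ (by simpa using h1) (by simpa using h2),
      sum_evalVal n ops tests _ _ (by simpa using h1) (by simpa using h2)]
    cases z <;> simp <;> ring

theorem RepOK.length_tests {rep : Rep ℝ} (hR : RepOK P T cells rep) : rep.tests.length = T := by
  rw [hR.tests_eq]
  simp

theorem sat_evaluate (hI : Inv P T cells) (hK : ∀ t ≤ T, (cell cells t).hist.length ≤ K)
    {rep : Rep ℝ} (hR : RepOK P T cells rep) (x : List Bool) :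
    Sat P T (evaluate rep x) (1 + x.length * evalStepCost K)
      (· = evalVal rep.ops rep.tests x [1] 1) := by
  have h1K : 1 ≤ K := le_trans (by simp [hI.hist_zero]) (hK 0 (Nat.zero_le _))
  rw [evaluate]
  refine (sat_one).bind fun u hu => ?_
  subst hu
  exact sat_evalFrom _ _ _ _ _ (hR.ops_ok.pick_length_le hK) (by simpa using h1K)

theorem RepOK.prob_eq (hI : Inv P T cells) {rep : Rep ℝ} (hR : RepOK P T cells rep)
    (x : List Bool) : rep.prob x = evalVal rep.ops rep.tests x [1] 1 := by
  -- Any finite bound will do, since only the value and not the cost is extracted.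
  obtain ⟨K, hK⟩ : ∃ K, ∀ t ≤ T, (cell cells t).hist.length ≤ K :=
    ⟨∑ t ∈ range (T + 1), (cell cells t).hist.length, fun t ht =>
      single_le_sum (f := fun t => (cell cells t).hist.length) (fun _ _ => Nat.zero_le _)
        (mem_range.2 (by omega))⟩
  exact (wp_exec _ (sat_evaluate hI hK hR x)).2

theorem RepOK.evalSteps_le (hI : Inv P T cells) (hK : ∀ t ≤ T, (cell cells t).hist.length ≤ K)
    {rep : Rep ℝ} (hR : RepOK P T cells rep) (x : Fin T → Bool) :
    rep.evalSteps (List.ofFn x) ≤ 1 + T * evalStepCost K := by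
  simpa [Rep.evalSteps] using (wp_exec _ (sat_evaluate hI hK hR (List.ofFn x))).1

theorem RepOK.isDistribution (hI : Inv P T cells) {rep : Rep ℝ} (hR : RepOK P T cells rep) :
    rep.IsDistribution T := by
  refine ⟨fun x => ?_, ?_⟩
  · rw [hR.prob_eq hI]
    exact evalVal_nonneg _ _ _ _ _ zero_le_one
  · simp only [hR.prob_eq hI]
    exact sum_evalVal T _ _ _ _ hR.ops_ok.length_eq hR.length_tests

/-- The representation is exact on sequences all of whose prefixes are predicted correctly. -/
theorem RepOK.evalVal_eq (hI : Inv P T cells) {rep : Rep ℝ} (hR : RepOK P T cells rep) :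
    ∀ x y : List Bool, y.length + x.length = T →
      (∀ t < T, Good P cells rep.ops ((y ++ x).take t)) →
      evalVal (rep.ops.drop y.length) (rep.tests.drop y.length) x (pushVec rep.ops y [1])
        (P.prob y) = P.prob (y ++ x)
  | [], y, h, _ => by
    have : rep.ops.drop y.length = [] := List.drop_eq_nil_of_le (by
      rw [hR.ops_ok.length_eq, ← h]; simp)
    rw [this, evalVal, List.append_nil]
    simp
  | o :: x, y, h, hg => by
    rw [List.length_cons] at h
    have hyT : y.length < T := by omega
    have hyO : y.length < rep.ops.length := by rwa [hR.ops_ok.length_eq]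
    have hyt : y.length < rep.tests.length := by rwa [hR.length_tests]
    have hgy : Good P cells rep.ops y := by simpa using hg y.length hyT
    -- Later tests are appended, so the first one is still the initial bit z_t, and goodness of `y`
    -- gives Pr[y z_t] exactly.
    obtain ⟨z, ts, hz⟩ := (hI.cellOK _ hyT.le).head hyT
    have htest : rep.tests[y.length] = (z, condVec P [z] (cell cells y.length).hist) := by
      simp only [hR.tests_eq, List.getElem_map, List.getElem_range, testVec, hz, List.headD_cons]
    have hq : ldot (condVec P [z] (cell cells y.length).hist) (pushVec rep.ops y [1]) =
        P.prob y * P.cond y [z] := by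
      rw [← SeqDist.prob_append]
      exact hgy [z] (by rw [hz]; simp)
    have hle : P.cond y [z] ≤ 1 := by
      linarith [P.cond_not_add y z, P.cond_nonneg y [!z]]
    have hp : P.prob y * (if o = z then clip (P.prob y * P.cond y [z]) (P.prob y)
        else 1 - clip (P.prob y * P.cond y [z]) (P.prob y)) = P.prob (y ++ [o]) := by
      rw [SeqDist.prob_append]
      split_ifs with ho
      · rw [mul_clip (P.cond_nonneg _ _) hle, ho]
      -- The other bit gets the complementary probability, as it does under `P`.
      · rw [mul_sub, mul_clip (P.cond_nonneg _ _) hle]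
        have : o = !z := by cases o <;> cases z <;> simp at ho ⊢
        rw [this]
        linear_combination -P.prob y * P.cond_not_add y z
    have ih := RepOK.evalVal_eq hI hR x (y ++ [o]) (by simp; omega) (by simpa using hg)
    rw [List.drop_eq_getElem_cons hyO, List.drop_eq_getElem_cons hyt, htest, evalVal, hq, hp]
    rw [pushVec_append_singleton o _ _ _ hyO, List.getD_eq_getElem _ _ hyO] at ih
    simpa using ih

theorem RepOK.prob_eq_of_good (hI : Inv P T cells) {rep : Rep ℝ} (hR : RepOK P T cells rep)
    {x : List Bool} (hx : x.length = T) (hg : ∀ t < T, Good P cells rep.ops (x.take t)) :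
    rep.prob x = P.prob x := by
  have := hR.evalVal_eq hI x [] (by simpa using hx) hg
  rw [hR.prob_eq hI]
  simpa [pushVec_nil, SeqDist.prob, SeqDist.cond] using this

/-! ### From wrong predictions to total variation -/

open Classical in
/-- The probability that the prediction for the prefix of length `t` is wrong. -/
noncomputable def errMass (P : SeqDist) (T : ℕ) (cells : List Cell)
    (ops : List (List (List ℝ) × List (List ℝ))) (t : ℕ) : ℝ :=
  ∑ x : Fin T → Bool, if ¬ Good P cells ops ((List.ofFn x).take t) then P.prob (List.ofFn x) else 0

/-- The estimate can be wrong only on sequences with a bad prefix; a union bound over the T lengths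
splits ε evenly. -/
theorem RepOK.tv_le (hI : Inv P T cells) {rep : Rep ℝ} (hR : RepOK P T cells rep) (hT : 0 < T)
    {ε : ℝ} (h : ∀ t, 1 ≤ t → t ≤ T → errMass P T cells rep.ops t ≤ ε / T) :
    P.tv T rep.prob ≤ ε := by
  classical
  have hd := hR.isDistribution hI
  refine (P.tv_le_of_eq_off hd.1 hd.2
    {x | ∃ t ∈ Icc 1 T, ¬ Good P cells rep.ops (x.take t)} fun x hx => ?_).trans ?_
  · refine hR.prob_eq_of_good hI (List.length_ofFn) fun t ht => ?_
    rcases Nat.eq_zero_or_pos t with rfl | h0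
    · rw [List.take_zero]
      exact good_nil hI
    · by_contra hb
      exact hx ⟨t, mem_Icc.2 ⟨h0, ht.le⟩, hb⟩
  · calc _ ≤ ∑ x : Fin T → Bool, ∑ t ∈ Icc 1 T,
          (if ¬ Good P cells rep.ops ((List.ofFn x).take t) then P.prob (List.ofFn x) else 0) := by
          refine sum_le_sum fun x _ => ?_
          have hnn : ∀ t ∈ Icc 1 T, 0 ≤ (if ¬ Good P cells rep.ops ((List.ofFn x).take t)
              then P.prob (List.ofFn x) else 0) := fun t _ => by
            split_ifs
            · exact le_rfl
            · exact P.prob_nonneg _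
          split_ifs with hx
          · obtain ⟨t, ht, hb⟩ := hx
            refine le_trans ?_ (single_le_sum hnn ht)
            rw [if_pos hb]
          · exact sum_nonneg hnn
      _ = ∑ t ∈ Icc 1 T, errMass P T cells rep.ops t := sum_comm
      _ ≤ ∑ _t ∈ Icc 1 T, ε / T := sum_le_sum fun t ht =>
          h t (mem_Icc.1 ht).1 (mem_Icc.1 ht).2
      _ = ε := by
          have : (T : ℝ) ≠ 0 := by exact_mod_cast hT.ne'
          simp
          field_simp

end ExactLearner

/-! ### The main loop -/

namespace ExactLearner

open Prog LinAlg Finset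

variable {P : SeqDist} {T r : ℕ} {cells : List Cell}

/-- The bound is r + 1 and not r because time 0 has one history and the rank hypothesis starts at
time 1. -/
theorem Inv.hist_length_le (hI : Inv P T cells) (hP : P.HasRank T r) :
    ∀ t ≤ T, (cell cells t).hist.length ≤ r + 1 := by
  intro t ht
  rcases Nat.eq_zero_or_pos t with rfl | h0
  · simp [hI.hist_zero]
  · exact ((hI.cellOK t ht).length_le_rank hP h0 ht).trans (Nat.le_succ r)

/-- One history at time 0 and at most r at each of the T later times. -/
theorem Inv.histCount_le (hI : Inv P T cells) (hP : P.HasRank T r) :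
    histCount cells ≤ 1 + r * T := by
  obtain ⟨c, cs, rfl⟩ : ∃ c cs, cells = c :: cs :=
    List.exists_cons_of_length_pos (by rw [hI.length_eq]; omega)
  have hl : cs.length = T := by simpa using hI.length_eq
  have h0 : c.hist = [[]] := hI.hist_zero
  have := List.sum_le_card_nsmul (cs.map fun c => c.hist.length) r fun m hm => by
    obtain ⟨c', hc, rfl⟩ := List.mem_map.1 hm
    obtain ⟨t, ht, rfl⟩ := List.getElem_of_mem hc
    have := (hI.cellOK (t + 1) (by omega)).length_le_rank hP (by omega) (by omega)
    rwa [cell, List.getD_cons_succ, List.getD_eq_getElem _ _ ht] at this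
  rw [List.length_map, hl, smul_eq_mul] at this
  rw [histCount, List.map_cons, List.sum_cons, h0, List.length_singleton, mul_comm r]
  omega

theorem sat_round (hI : Inv P T cells) (hP : P.HasRank T r) (n : ℕ) :
    Sat P T (round T n cells) (roundCost T (r + 1) n) fun res =>
      (∀ cells', res = .inl cells' → Inv P T cells' ∧ histCount cells' = histCount cells + 1) ∧
      ∀ rep, res = .inr rep → RepOK P T cells rep := by
  have hK := hI.hist_length_le hP
  rw [round_eq]
  exact ((sat_operators hI hK).bind fun ops hO => (sat_sampleAll n).bind fun xs hxs =>
    (sat_search hI hO hK hxs.1 hxs.2).imp fun res h => ⟨h.1, fun rep hr => (h.2 rep hr).2.1⟩).le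
      (by simp only [roundCost]; omega)

/-- Here `m` exceeds the number of histories that can still be added, so the loop returns within `m`
rounds. The truncation `N` only has to be at least `m` and does not enter the cost. -/
theorem sat_rounds (hP : P.HasRank T r) (n : ℕ) : ∀ (m N : ℕ) (cells : List Cell), Inv P T cells →
    1 + r * T < histCount cells + m → m ≤ N →
    Sat P T (rounds T n N cells) (m * (roundCost T (r + 1) n + 1)) fun o =>
      ∃ cells' rep, o = some rep ∧ Inv P T cells' ∧ RepOK P T cells' rep
  | 0, _, cells, hI, h, _ => absurd (hI.histCount_le hP) (by omega)
  | m + 1, 0, cells, _, _, h => by omega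
  | m + 1, N + 1, cells, hI, h, hN => by
    rw [rounds]
    refine ((sat_tick 1).bind fun _ _ => (sat_round hI hP n).bind
      (B₂ := m * (roundCost T (r + 1) n + 1)) fun res hres => ?_).le
        (by rw [Nat.succ_mul m]; omega)
    match res, hres with
    | .inl cells', hres =>
      obtain ⟨h1, h2⟩ := hres.1 cells' rfl
      exact sat_rounds hP n m N cells' h1 (by omega) (by omega)
    | .inr rep, hres =>
      exact (Sat.pure (Q := fun o => ∃ cells' rep, o = some rep ∧ Inv P T cells' ∧
        RepOK P T cells' rep) ⟨cells, rep, rfl, hI, hres.2 rep rfl⟩).le (by omega)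

/-- The cost of `init`. -/
def initCost {S : Type*} [CommSemiring S] (T : S) : S := (T + 1) * ((T + 1) + (1 + T) + 1 + 1 + 1)

theorem CellOK.singleton {t : ℕ} (h f : List Bool) (hh : h.length = t)
    (hf : t + f.length ≤ T) (hz : t < T → ∃ z, f = [z]) (h0 : P.cond h f ≠ 0) :
    CellOK P T t ⟨[h], [f]⟩ := by
  refine ⟨by simpa using hh, by simpa using hf, rfl, fun htT => ?_, fun v hv i hi => ?_⟩
  · obtain ⟨z, rfl⟩ := hz htT
    exact ⟨z, [], rfl⟩
  · have := hv f (by simp)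
    simp only [List.length_singleton, sum_range_one, List.getD_cons_zero, mul_eq_zero] at this
    simp only [List.length_singleton, Nat.lt_one_iff] at hi
    subst hi
    exact this.resolve_left h0

theorem sat_init : Sat P T (init T) (initCost T) fun cells =>
    Inv P T cells ∧ histCount cells = T + 1 := by
  rw [init]
  refine (sat_forEach (B := (T + 1) + (1 + T) + 1 + 1)
    (R := fun t c => CellOK P T t c ∧ c.hist = [List.replicate t false]) fun t ht => ?_).mono
      (by rw [List.length_range]; rfl) fun cells hc => ?_
  · have ht : t ≤ T := by have := List.mem_range.1 ht; omega
    refine (((sat_tick (t + 1)).le (show t + 1 ≤ T + 1 by omega)).bind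
      (B₂ := (1 + T) + 1 + 1) fun _ _ => ?_).le (by omega)
    split_ifs with h
    · subst h
      refine (Sat.pure (Q := fun c => CellOK P t t c ∧ c.hist = [List.replicate t false])
        ⟨?_, rfl⟩).le (by omega)
      -- At time T the only test is φ, whose conditional probability is 1.
      exact CellOK.singleton _ _ (by simp) (by simp) (by simp) (by simp [SeqDist.cond])
    · refine (sat_askCond (by simp; omega)).bind fun p hp => (sat_zero).bind fun z hz =>
        (sat_isEq p z).bind (B₂ := 0) fun b hb => Sat.pure ⟨?_, rfl⟩
      subst hp hz hb
      refine CellOK.singleton _ _ (by simp) (by simp; omega) (fun _ => ⟨_, rfl⟩) ?_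
      -- The test bit is the outcome of the comparison: if Pr[0 | 0^t] = 0 it is 1, with conditional
      -- probability 1, and otherwise it is 0.
      by_cases h0 : P.cond (List.replicate t false) [false] = 0
      · have := P.cond_not_add (List.replicate t false) false
        rw [h0, add_zero] at this
        simp [h0, show P.cond (List.replicate t false) [true] = 1 from this]
      · simp [h0]
  · obtain ⟨h1, h2⟩ := forall₂_range ⟨[], []⟩ hc
    refine ⟨⟨h1, (h2 0 (by omega)).2, fun t ht => (h2 t (by omega)).1⟩, ?_⟩
    have h3 := forall₂_const (p := fun c : Cell => c.hist.length = 1)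
      (hc.imp fun t c h => by simp [h.2])
    rw [histCount, List.eq_replicate_of_mem (a := 1) (l := cells.map _)]
    · simp [h1]
    · intro m hm
      obtain ⟨c, hc, rfl⟩ := List.mem_map.1 hm
      exact h3.2 c hc

theorem sat_learn (hP : P.HasRank T r) (n : ℕ) {N : ℕ} (hN : r * T + 1 ≤ N) :
    Sat P T (learn T n N) (initCost T + (r * T + 1) * (roundCost T (r + 1) n + 1)) fun o =>
      ∃ cells' rep, o = some rep ∧ Inv P T cells' ∧ RepOK P T cells' rep := by
  rw [learn]
  exact sat_init.bind fun cells h => sat_rounds hP n _ N cells h.1 (by omega) hN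

/-! ### The probability of failure -/

theorem _root_.PMF.toOuterMeasure_eq_zero {α : Type} (p : PMF α) (s : Set α)
    (h : ∀ a ∈ p.support, a ∉ s) : p.toOuterMeasure s = 0 :=
  (PMF.toOuterMeasure_apply_eq_zero_iff p s).2 (Set.disjoint_left.2 h)

/-- Only the block of length `t` matters: its n independent draws each give a good prefix with
probability at most 1 - η, and the other blocks contribute factors at most 1. -/
theorem law_sampleAll_le (ops : List (List (List ℝ) × List (List ℝ))) (n : ℕ) {η : ℝ}
    {t : ℕ} (h1 : 1 ≤ t) (hT : t ≤ T) (hη : η ≤ errMass P T cells ops t) :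
    (law P T (sampleAll T n)).toOuterMeasure {xs | ∀ x ∈ xs, Good P cells ops x} ≤
      ENNReal.ofReal (1 - η) ^ n := by
  classical
  have hmass : (P.joint T).toOuterMeasure {x | Good P cells ops (x.take t)} ≤
      ENNReal.ofReal (1 - η) := by
    rw [P.toOuterMeasure_joint]
    refine ENNReal.ofReal_le_ofReal ?_
    have : (∑ x : Fin T → Bool, if List.ofFn x ∈ {x : List Bool | Good P cells ops (x.take t)}
        then P.prob (List.ofFn x) else 0) + errMass P T cells ops t = 1 := by
      rw [errMass, ← sum_add_distrib, ← P.sum_prob T]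
      refine sum_congr rfl fun x _ => ?_
      by_cases hx : Good P cells ops ((List.ofFn x).take t) <;> simp [hx]
    linarith
  rw [sampleAll, law_bind, ← add_zero (ENNReal.ofReal (1 - η) ^ n)]
  refine PMF.toOuterMeasure_bind_le _ _ _
    {bs | ∀ b ∈ bs, b ∈ {b | ∀ x ∈ b, x ∈ {x | Good P cells ops x}}} _ _ ?_ fun bs _ hbs => ?_
  · rw [law_forEach_all]
    have hmem : t ∈ List.range' 1 T := List.mem_range'_1.2 (by omega)
    have hle : ∀ (l : List ℕ) (f : ℕ → ENNReal), (∀ i, f i ≤ 1) → t ∈ l →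
        (l.map f).prod ≤ f t := by
      intro l f hf ht
      obtain ⟨l₁, l₂, rfl⟩ := List.append_of_mem ht
      have hp : ∀ l : List ℕ, (l.map f).prod ≤ 1 := fun l => by
        induction l with
        | nil => simp
        | cons i l ih =>
          rw [List.map_cons, List.prod_cons]
          exact mul_le_one' (hf i) ih
      rw [List.map_append, List.prod_append, List.map_cons, List.prod_cons]
      calc (l₁.map f).prod * (f t * (l₂.map f).prod) ≤ 1 * (f t * 1) := by
            gcongr
            · exact hp l₁
            · exact hp l₂
        _ = f t := by simp
    refine (hle _ _ (fun i => PMF.toOuterMeasure_le_one _ _) hmem).trans ?_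
    rw [law_forEach_all, List.map_const', List.prod_replicate, List.length_range]
    refine pow_le_pow_left' (le_trans ?_ hmass) n
    rw [law_bind, law_draw, PMF.toOuterMeasure_bind_apply, PMF.toOuterMeasure_apply]
    refine ENNReal.tsum_le_tsum fun x => ?_
    rw [law_pure, PMF.toOuterMeasure_pure_apply]
    by_cases hx : Good P cells ops (x.take t) <;> simp [Set.indicator, hx]
  · rw [law_bind, law_tick, PMF.pure_bind, law_pure]
    refine (PMF.toOuterMeasure_eq_zero _ _ fun a ha h => hbs fun b hb x hx => ?_).le
    rw [PMF.mem_support_pure_iff] at ha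
    subst ha
    exact h x (List.mem_flatten.2 ⟨b, hb, hx⟩)

theorem law_round_le (hI : Inv P T cells) (hP : P.HasRank T r) (hT : 0 < T) (n : ℕ) (ε : ℝ) :
    (law P T (round T n cells)).toOuterMeasure {res | ∃ rep, res = .inr rep ∧ ε < P.tv T rep.prob} ≤
      ENNReal.ofReal (1 - ε / T) ^ n := by
  have hK := hI.hist_length_le hP
  rw [round_eq, law_bind]
  refine PMF.toOuterMeasure_bind_le' _ _ _ _ fun ops hO => ?_
  have hO := (sat_operators hI hK).law ops hO
  rw [law_bind, ← add_zero (ENNReal.ofReal (1 - ε / T) ^ n)]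
  -- If all error masses are small, whatever is returned is accurate. Otherwise an inaccurate return
  -- forces all samples at some bad length to be good.
  by_cases hgood : ∀ t, 1 ≤ t → t ≤ T → errMass P T cells ops t ≤ ε / T
  · refine PMF.toOuterMeasure_bind_le _ _ _ ∅ _ _ (by simp) fun xs hxs _ => ?_
    have hxs := (sat_sampleAll n).law xs hxs
    refine (PMF.toOuterMeasure_eq_zero _ _ ?_).le
    rintro res hres ⟨rep, rfl, hlt⟩
    obtain ⟨rfl, hR, _⟩ := ((sat_search hI hO hK hxs.1 hxs.2).law _ hres).2 rep rfl
    exact (hR.tv_le hI hT hgood).not_gt hlt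
  · push Not at hgood
    obtain ⟨t, h1, h2, h3⟩ := hgood
    refine PMF.toOuterMeasure_bind_le _ _ _ _ _ _ (law_sampleAll_le ops n h1 h2 h3.le)
      fun xs hxs hbad => ?_
    have hxs := (sat_sampleAll n).law xs hxs
    refine (PMF.toOuterMeasure_eq_zero _ _ ?_).le
    rintro res hres ⟨rep, rfl, hlt⟩
    exact hbad (((sat_search hI hO hK hxs.1 hxs.2).law _ hres).2 rep rfl).2.2

/-- Union bound over rounds: `not in F` after a round that returns, induction with one more history
after a round that does not. -/
theorem law_rounds_le (hP : P.HasRank T r) (hT : 0 < T) (n : ℕ) (ε : ℝ) :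
    ∀ (m N : ℕ) (cells : List Cell), Inv P T cells → 1 + r * T < histCount cells + m → m ≤ N →
    (law P T (rounds T n N cells)).toOuterMeasure
      {o | ¬ ∃ rep, o = some rep ∧ P.tv T rep.prob ≤ ε} ≤ m * ENNReal.ofReal (1 - ε / T) ^ n
  | 0, _, cells, hI, h, _ => absurd (hI.histCount_le hP) (by omega)
  | m + 1, 0, cells, _, _, h => by omega
  | m + 1, N + 1, cells, hI, h, hN => by
    rw [rounds, law_bind, law_tick, PMF.pure_bind, law_bind, Nat.cast_succ, add_mul, one_mul,
      add_comm]
    refine PMF.toOuterMeasure_bind_le _ _ _ _ _ _ (law_round_le hI hP hT n ε)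
      fun res hres hnot => ?_
    have hres := (sat_round hI hP n).law res hres
    match res, hres, hnot with
    | .inl cells', hres, _ =>
      obtain ⟨h1, h2⟩ := hres.1 cells' rfl
      exact law_rounds_le hP hT n ε m N cells' h1 (by omega) (by omega)
    | .inr rep, hres, hnot =>
      refine (PMF.toOuterMeasure_eq_zero _ _ fun o ho hF => ?_).le.trans zero_le
      simp only [law_pure, PMF.mem_support_pure_iff] at ho
      subst ho
      exact hF ⟨rep, rfl, not_lt.1 fun hlt => hnot ⟨rep, rfl, hlt⟩⟩

theorem law_learn_le (hP : P.HasRank T r) (hT : 0 < T) (n : ℕ) (ε : ℝ) {N : ℕ} (hN : r * T ≤ N) :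
    (law P T (learn T n N)).toOuterMeasure
      {o | ¬ ∃ rep, o = some rep ∧ P.tv T rep.prob ≤ ε} ≤
        (r * T : ℕ) * ENNReal.ofReal (1 - ε / T) ^ n := by
  rw [learn, law_bind]
  refine PMF.toOuterMeasure_bind_le' _ _ _ _ fun cells hc => ?_
  have hc := sat_init.law cells hc
  -- Since T > 0, the initial T + 1 histories already leave room for at most rT rounds, the factor
  -- that appears in log(rT/δ).
  exact law_rounds_le hP hT n ε _ N cells hc.1 (by omega) hN

end ExactLearner

/-! ### Total cost and the main theorem -/

namespace ExactLearner

open Prog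

/-- A bound on the number of steps of the algorithm, on that of an evaluation, and on the number of
rounds, for rank `r`, sequence length `T` and `n` samples. -/
def totalCost {S : Type*} [CommSemiring S] (r T n : S) : S :=
  initCost T + (r * T + 1) * (roundCost T (r + 1) n + 1) + (1 + T * evalStepCost (r + 1)) +
    (r * T + 1)

/-- The same expression is a step count in ℕ, a real number and a polynomial. Commuting with ring
homomorphisms identifies them, so the polynomial need not be expanded. -/
theorem map_totalCost {S S' : Type*} [CommSemiring S] [CommSemiring S'] (f : S →+* S') (r T n : S) :
    f (totalCost r T n) = totalCost (f r) (f T) (f n) := by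
  simp only [totalCost, initCost, roundCost, evalStepCost, operatorCost, sampleCost, searchCost,
    checkCost, LinAlg.pivotCost, map_add, map_mul, map_one, map_ofNat]

theorem totalCost_mono {r T n n' : ℝ} (hr : 0 ≤ r) (hT : 0 ≤ T) (h : n ≤ n') :
    totalCost r T n ≤ totalCost r T n' := by
  simp only [totalCost, initCost, roundCost, evalStepCost, operatorCost, sampleCost, searchCost,
    checkCost, LinAlg.pivotCost]
  gcongr

/-- The polynomial of the theorem in the variables `r`, `T`, `1 / ε` and `log (1 / δ)`. -/
noncomputable def costPoly : MvPolynomial (Fin 4) ℝ :=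
  totalCost (MvPolynomial.X 0) (MvPolynomial.X 1)
    ((MvPolynomial.X 1) ^ 4 * (MvPolynomial.X 0 + MvPolynomial.X 1 + MvPolynomial.X 3) *
      (MvPolynomial.X 2) ^ 2 + 1)

theorem eval_costPoly (a b c d : ℝ) : MvPolynomial.eval ![a, b, c, d] costPoly =
    totalCost a b (b ^ 4 * (a + b + d) * c ^ 2 + 1) := by
  rw [costPoly, map_totalCost]
  simp

theorem sampleSize_le (r T : ℕ) {ε δ : ℝ} (h0 : 0 < δ) (h1 : δ < 1) :
    (sampleSize 1 r T ε δ : ℝ) ≤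
      (T : ℝ) ^ 4 * (r + T + Real.log (1 / δ)) * (1 / ε) ^ 2 + 1 := by
  have hd : 0 < Real.log (1 / δ) := Real.log_pos (by rw [lt_div_iff₀ h0]; linarith)
  have hlog : Real.log (r * T / δ) ≤ r + T + Real.log (1 / δ) := by
    by_cases h : (r : ℝ) * T = 0
    -- If rT = 0 the logarithm takes its default value 0; otherwise log(rT/δ) splits and log a ≤ a
    -- applies to r and T.
    · rw [h, zero_div, Real.log_zero]
      positivity
    · obtain ⟨hr, hT⟩ := mul_ne_zero_iff.1 h
      rw [mul_div_assoc, Real.log_mul hr (div_ne_zero hT h0.ne'), div_eq_mul_one_div,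
        Real.log_mul hT (one_div_ne_zero h0.ne')]
      linarith [Real.log_le_self (Nat.cast_nonneg (α := ℝ) r),
        Real.log_le_self (Nat.cast_nonneg (α := ℝ) T)]
  have hle : 1 * (T : ℝ) ^ 4 * Real.log (r * T / δ) / ε ^ 2 ≤
      (T : ℝ) ^ 4 * (r + T + Real.log (1 / δ)) * (1 / ε) ^ 2 := by
    rw [one_mul, one_div_pow, mul_one_div]
    gcongr
  rw [sampleSize]
  exact (Nat.cast_le.2 (Nat.ceil_mono hle)).trans (Nat.ceil_lt_add_one (by positivity)).le

/-- The union bound over the rounds. -/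
theorem failure_le {r T : ℕ} (hr : 0 < r) (hT : 0 < T) {ε δ : ℝ} (hε : 0 < ε) (hε1 : ε < 1)
    (h0 : 0 < δ) (h1 : δ < 1) :
    ((r * T : ℕ) : ENNReal) * ENNReal.ofReal (1 - ε / T) ^ sampleSize 1 r T ε δ ≤
      ENNReal.ofReal δ := by
  have hT1 : (1 : ℝ) ≤ T := by exact_mod_cast hT
  have hT0 : (0 : ℝ) < T := by linarith
  have hR1 : (1 : ℝ) ≤ (r : ℝ) * T := by exact_mod_cast Nat.mul_pos hr hT
  have hnn : 0 ≤ 1 - ε / T := by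
    rw [sub_nonneg, div_le_one hT0]
    linarith
  have hL : 0 ≤ Real.log (r * T / δ) := Real.log_nonneg (by rw [le_div_iff₀ h0]; linarith)
  have hn : Real.log (r * T / δ) ≤ sampleSize 1 r T ε δ * (ε / T) := by
    -- With C = 1, n ε/T is at least (T³/ε) log(rT/δ), and T³/ε ≥ 1; the sample size has slack.
    calc Real.log (r * T / δ) ≤ Real.log (r * T / δ) * ((T : ℝ) ^ 3 / ε) := by
          refine le_mul_of_one_le_right hL ?_
          rw [le_div_iff₀ hε, one_mul]
          exact hε1.le.trans (one_le_pow₀ hT1)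
      _ = 1 * (T : ℝ) ^ 4 * Real.log (r * T / δ) / ε ^ 2 * (ε / T) := by
          field_simp
      _ ≤ sampleSize 1 r T ε δ * (ε / T) := by
          gcongr
          exact Nat.le_ceil _
  rw [← ENNReal.ofReal_pow hnn, ← ENNReal.ofReal_natCast, ← ENNReal.ofReal_mul (Nat.cast_nonneg _)]
  refine ENNReal.ofReal_le_ofReal ?_
  have hpow : (1 - ε / T) ^ sampleSize 1 r T ε δ ≤ δ / (r * T) := by
    calc (1 - ε / T) ^ sampleSize 1 r T ε δ
        ≤ Real.exp (-(ε / T)) ^ sampleSize 1 r T ε δ :=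
          pow_le_pow_left₀ hnn (Real.one_sub_le_exp_neg _) _
      _ = Real.exp (-(sampleSize 1 r T ε δ * (ε / T))) := by
          rw [← Real.exp_nat_mul]
          congr 1
          ring
      _ ≤ Real.exp (-Real.log (r * T / δ)) := Real.exp_le_exp.2 (neg_le_neg hn)
      _ = δ / (r * T) := by
          rw [Real.exp_neg, Real.exp_log (by positivity), inv_div]
  push_cast
  calc (r : ℝ) * T * (1 - ε / T) ^ sampleSize 1 r T ε δ ≤ (r : ℝ) * T * (δ / (r * T)) := by gcongr
    _ = δ := by field_simp

/-- There is a single sequence of length 0, and both distributions give it mass 1. -/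
theorem tv_eq_zero_of_length_zero (P : SeqDist) {rep : Rep ℝ} (h : rep.IsDistribution 0) :
    P.tv 0 rep.prob = 0 := by
  have h1 := h.2
  simp only [List.ofFn_zero, Finset.sum_const, Finset.card_univ, Fintype.card_unique,
    one_smul] at h1
  simp [SeqDist.tv, h1, SeqDist.prob, SeqDist.cond]

end ExactLearner

theorem theorem1 :
    ∃ (C : ℝ) (p : MvPolynomial (Fin 4) ℝ), 0 < C ∧
      ∀ (T r : ℕ) (P : SeqDist), P.HasRank T r →
      ∀ ε δ : ℝ, 0 < ε → ε < 1 → 0 < δ → δ < 1 →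
      ∀ bound : ℝ, bound = MvPolynomial.eval ![(r : ℝ), (T : ℝ), 1 / ε, Real.log (1 / δ)] p →
      ∀ N : ℕ, bound ≤ N →
        (∀ out ∈ ((ExactLearner.learn T (ExactLearner.sampleSize C r T ε δ) N).run P T).support,
          (out.2 : ℝ) ≤ bound ∧
          ∃ rep, out.1 = some rep ∧ rep.IsDistribution T ∧
            ∀ x : Fin T → Bool, (rep.evalSteps (List.ofFn x) : ℝ) ≤ bound) ∧
        ENNReal.ofReal (1 - δ) ≤
          ((ExactLearner.learn T (ExactLearner.sampleSize C r T ε δ) N).run P T).toOuterMeasure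
            {out | ∃ rep, out.1 = some rep ∧ P.tv T rep.prob ≤ ε} := by
  refine ⟨1, ExactLearner.costPoly, one_pos, fun T r P hP ε δ hε hε1 hδ hδ1 bound hbound N hN => ?_⟩
  have hcost : ((ExactLearner.totalCost r T (ExactLearner.sampleSize 1 r T ε δ) : ℕ) : ℝ) ≤ bound := by
    rw [hbound, ExactLearner.eval_costPoly, ← Nat.coe_castRingHom, ExactLearner.map_totalCost]
    exact ExactLearner.totalCost_mono (Nat.cast_nonneg _) (Nat.cast_nonneg _) (ExactLearner.sampleSize_le r T hδ hδ1)
  generalize hn : ExactLearner.sampleSize 1 r T ε δ = n at hcost ⊢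
  have hNt : ExactLearner.totalCost r T n ≤ N := by exact_mod_cast hcost.trans hN
  -- `totalCost` carries the extra summand rT + 1 so that every admissible N also exceeds the number
  -- of rounds.
  have hNr : r * T + 1 ≤ N := le_trans (by simp only [ExactLearner.totalCost]; omega) hNt
  have hlearn : ∀ out ∈ ((ExactLearner.learn T n N).run P T).support,
      (out.2 : ℝ) ≤ bound ∧ ∃ rep, out.1 = some rep ∧ rep.IsDistribution T ∧
        ∀ x : Fin T → Bool, (rep.evalSteps (List.ofFn x) : ℝ) ≤ bound := by
    intro out ho
    obtain ⟨h1, cells, rep, h2, hI, hR⟩ := Prog.wp_run _ (ExactLearner.sat_learn hP n hNr) out ho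
    refine ⟨(Nat.cast_le.2 (h1.trans ?_)).trans hcost, rep, h2, hR.isDistribution hI, fun x =>
      (Nat.cast_le.2 ((hR.evalSteps_le hI (hI.hist_length_le hP) x).trans ?_)).trans hcost⟩
    · simp only [ExactLearner.totalCost]; omega
    · simp only [ExactLearner.totalCost]; omega
  refine ⟨hlearn, ?_⟩
  rcases Nat.eq_zero_or_pos T with rfl | hT
  · rw [(PMF.toOuterMeasure_apply_eq_one_iff _ _).2]
    · exact ENNReal.ofReal_le_one.2 (by linarith)
    · intro out ho
      obtain ⟨-, rep, h1, h2, -⟩ := hlearn out ho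
      exact ⟨rep, h1, (ExactLearner.tv_eq_zero_of_length_zero P h2).trans_le hε.le⟩
  -- Rank 0 is impossible for T > 0: already after initialization the count gives T + 1 ≤ 1 + rT.
  · have hr : 0 < r := by
      obtain ⟨out, ho⟩ := ((Prog.law P T (ExactLearner.init T)).support_nonempty)
      have hI := ExactLearner.sat_init.law out ho
      have hcount := hI.1.histCount_le hP
      rw [hI.2] at hcount
      refine Nat.pos_of_ne_zero fun h => ?_
      rw [h, zero_mul] at hcount
      omega
    set F : Set (Option (ExactLearner.Rep ℝ)) := {o | ¬ ∃ rep, o = some rep ∧ P.tv T rep.prob ≤ ε}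
    have hF : ((ExactLearner.learn T n N).run P T).toOuterMeasure (Prod.fst ⁻¹' F) ≤ ENNReal.ofReal δ := by
      rw [← PMF.toOuterMeasure_map_apply]
      refine (ExactLearner.law_learn_le hP hT n ε (by omega)).trans ?_
      rw [← hn]
      exact ExactLearner.failure_le hr hT hε hε1 hδ hδ1
    set G : Set (Option (ExactLearner.Rep ℝ) × ℕ) := {out | ∃ rep, out.1 = some rep ∧ P.tv T rep.prob ≤ ε}
    -- Success and failure cover all outcomes, so subadditivity turns the bound δ on failure into 1
    -- - δ for success.
    have hone : 1 ≤ ((ExactLearner.learn T n N).run P T).toOuterMeasure G +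
        ((ExactLearner.learn T n N).run P T).toOuterMeasure (Prod.fst ⁻¹' F) := by
      rw [← (PMF.toOuterMeasure_apply_eq_one_iff ((ExactLearner.learn T n N).run P T) Set.univ).2
        (Set.subset_univ _)]
      refine (MeasureTheory.measure_mono fun out _ => ?_).trans
        (MeasureTheory.measure_union_le G (Prod.fst ⁻¹' F))
      exact em (out ∈ G)
    rw [ENNReal.ofReal_sub _ hδ.le, ENNReal.ofReal_one, tsub_le_iff_right]
    exact hone.trans (by gcongr)
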